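/- Let $k_1,k_2>0$, $\mu\in\mathbb R$, $\sigma>0$, and let $f_0(x)=\sigma^{-1}h((x-\mu)/\sigma)$ be a member of the asymmetric extended Huber family, where $$\log h(x)=\begin{cases} k_1x+\tfrac{k_1^2}{2}-c, & x<-k_1,\\ -\tfrac{x^2}{2}-c, & -k_1\le x\le k_2,\\ -k_2x+\tfrac{k_2^2}{2}-c, & x>k_2,\end{cases}\qquad c=\log\Bigl(\tfrac{e^{-k_1^2/2}}{k_1}+\tfrac{e^{-k_2^2/2}}{k_2}+\sqrt{2\pi}\,(\Phi(k_2)-\Phi(-k_1))\Bigr),$$ with $\Phi$ the standard normal distribution function. Let $F_0$ be the distribution function of $f_0$, and $I(f_0)=\int (f_0'/f_0)^2f_0\,dx$ its Fisher information for location. Consider a randomized experiment under the constant additive treatment effect model: the triples $(Z_i,Y_i(0),Y_i(1))$, $i=1,2,\dots$, are i.i.d.; $Z_i\in\{0,1\}$ is independent of $(Y_i(0),Y_i(1))$ with $P(Z_i=1)=p\in(0,1)$; $Y_i(0)$ has density $f_0$ and $Y_i(1)$ has density $f_0(\cdot-\tau)$. One observes $Z_i$ and $Y_i=Y_i(Z_i)$.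 Let $\alpha=F_0(\mu-\sigma k_1)$ and $1-\beta=F_0(\mu+\sigma k_2)$, and let $$\hat\tau_{\alpha,\beta}=\frac{1}{1-(\alpha+\beta)}\int_\alpha^{1-\beta}\bigl(\hat F_1^{-1}(u)-\hat F_0^{-1}(u)\bigr)\,du ,$$ where $\hat F_z^{-1}(u)=\inf\{x:\hat F_z(x)\ge u\}$ and $\hat F_z$ is the empirical distribution function of the outcomes with $Z_i=z$ among the first $n$ observations. Then: (i) $\alpha,\beta>0$, $\alpha+\beta<1$ and $I(f_0)=(1-\alpha-\beta)/\sigma^2$ (so $I(f_0)=1-\alpha-\beta$ when $\sigma=1$). (ii) The semiparametric information bound for $\tau$ at $(f_0,\tau)$ is $\frac{1}{p(1-p)I(f_0)}$. Here the model consists of all laws of $(Z,Y)$ with $Z\sim\mathrm{Bernoulli}(p)$, $p$ fixed, such that $Y$ has density $f$ given $Z=0$ and $f(\cdot-t)$ given $Z=1$, where $t\in\mathbb R$ and $f$ is an unknown differentiable probability density with $0<I(f)<\infty$. A regular submodel is a one-parameter curve in this model through $(f_0,\tau)$ that is differentiable in quadratic mean and along which the effect is differentiable at that point. The bound is the supremum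 of the Cramér–Rao bounds $(\text{derivative of the effect})^2/(\text{information})$ over the regular submodels with positive information. (iii) $\sqrt n\,(\hat\tau_{\alpha,\beta}-\tau)$ converges in distribution to $\mathcal N\bigl(0,\frac{1}{p(1-p)I(f_0)}\bigr)$ as $n\to\infty$. (iv) $\hat\tau_{\alpha,\beta}$ is efficient for $\tau$ at $(f_0,\tau)$ in the model of (ii): $\sqrt n(\hat\tau_{\alpha,\beta}-\tau)=n^{-1/2}\sum_{i=1}^n\psi(Z_i,Y_i)+o_P(1)$, where $\psi$ is the efficient influence function, i.e. $\psi$ has mean zero and finite variance, the derivative of the effect along every regular submodel is the covariance of $\psi$ with the score of that submodel, and $\psi$ lies in the $L^2$-closed linear span of the scores of the regular submodels. -/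

import Mathlib

open MeasureTheory ProbabilityTheory Filter Topology

noncomputable section

/-! ### Densities -/

/-- The measure on the line with Lebesgue density `f`. -/
def densityMeasure (f : ℝ → ℝ) : Measure ℝ :=
  volume.withDensity fun x => ENNReal.ofReal (f x)

/-- The distribution function of the law with density `f`. -/
def densityCDF (f : ℝ → ℝ) (x : ℝ) : ℝ :=
  (densityMeasure f).real (Set.Iic x)

/-- The location score `f' / f`. -/
def locationScore (f : ℝ → ℝ) (x : ℝ) : ℝ := deriv f x / f x

/-- The Fisher information for location, `I(f) = ∫ (f'/f)² f`. -/
def fisherInfo (f : ℝ → ℝ) : ℝ := ∫ x, locationScore f x ^ 2 * f x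

/-- Probability densities `f` such that `f'` exists and `0 < I(f) < ∞`. -/
structure IsRegularDensity (f : ℝ → ℝ) : Prop where
  nonneg : ∀ x, 0 ≤ f x
  integrable : Integrable f
  integral_eq_one : ∫ x, f x = 1
  differentiable : Differentiable ℝ f
  integrable_info : Integrable fun x => locationScore f x ^ 2 * f x
  info_pos : 0 < fisherInfo f

/-! ### The asymmetric extended Huber family -/

/-- The distribution function of the standard normal law. -/
def stdNormalCDF (x : ℝ) : ℝ := (gaussianReal 0 1).real (Set.Iic x)

/-- The logarithm of the normalizing constant of the extended Huber density. -/
def huberLogConst (k₁ k₂ : ℝ) : ℝ :=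
  Real.log (Real.exp (-k₁ ^ 2 / 2) / k₁ + Real.exp (-k₂ ^ 2 / 2) / k₂
    + √(2 * Real.pi) * (stdNormalCDF k₂ - stdNormalCDF (-k₁)))

/-- The logarithm of the standardized extended Huber density: Gaussian on `[-k₁, k₂]`, with
exponential tails of rates `k₁` (left) and `k₂` (right). -/
def huberLogDensity (k₁ k₂ x : ℝ) : ℝ :=
  if x < -k₁ then k₁ * x + k₁ ^ 2 / 2 - huberLogConst k₁ k₂
  else if x ≤ k₂ then -x ^ 2 / 2 - huberLogConst k₁ k₂
  else -k₂ * x + k₂ ^ 2 / 2 - huberLogConst k₁ k₂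

/-- The density of `X` when `(X - μ) / σ` has the standardized extended Huber density. -/
def huberDensity (k₁ k₂ μ σ x : ℝ) : ℝ :=
  σ⁻¹ * Real.exp (huberLogDensity k₁ k₂ ((x - μ) / σ))

/-! ### The randomized experiment and the trimmed mean difference -/

/-- A randomized experiment (Bernoulli assignment) on a random sample: the triples `(Zᵢ, Yᵢ(0), Yᵢ(1))` are
i.i.d., the treatment `Zᵢ` (`true` = treated) is independent of the potential outcomes
`(Yᵢ(0), Yᵢ(1))`, and a unit is treated with probability `p`. -/
structure IsRandomizedExperiment {Ω : Type*} [MeasurableSpace Ω] (P : Measure Ω) (p : ℝ)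
    (Z : ℕ → Ω → Bool) (Y0 Y1 : ℕ → Ω → ℝ) : Prop where
  measurable_Z : ∀ i, Measurable (Z i)
  measurable_Y0 : ∀ i, Measurable (Y0 i)
  measurable_Y1 : ∀ i, Measurable (Y1 i)
  indep : iIndepFun (fun i ω => (Z i ω, Y0 i ω, Y1 i ω)) P
  ident : ∀ i, IdentDistrib (fun ω => (Z i ω, Y0 i ω, Y1 i ω))
    (fun ω => (Z 0 ω, Y0 0 ω, Y1 0 ω)) P P
  randomized : ∀ i, IndepFun (Z i) (fun ω => (Y0 i ω, Y1 i ω)) P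
  treated_prob : ∀ i, P.real {ω | Z i ω = true} = p

/-- The observed data `(Zᵢ, Yᵢ)`, `Yᵢ = Yᵢ(Zᵢ)`. -/
def observed {Ω : Type*} (Z : ℕ → Ω → Bool) (Y0 Y1 : ℕ → Ω → ℝ) (i : ℕ) (ω : Ω) : Bool × ℝ :=
  (Z i ω, if Z i ω = true then Y1 i ω else Y0 i ω)

/-- The empirical distribution function of the outcomes in the treatment arm `z`, based on the
observations with indices `0, …, n - 1`. -/
def empiricalCDF (z : Bool) (n : ℕ) (d : ℕ → Bool × ℝ) (x : ℝ) : ℝ :=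
  (((Finset.range n).filter fun i => (d i).1 = z ∧ (d i).2 ≤ x).card : ℝ) /
    (((Finset.range n).filter fun i => (d i).1 = z).card : ℝ)

/-- The quantile function `F⁻¹(u) = inf {x | u ≤ F x}`. -/
def quantile (F : ℝ → ℝ) (u : ℝ) : ℝ := sInf {x | u ≤ F x}

/-- The difference of the `(α, β)`-trimmed means of the two arms,
`(1 - (α + β))⁻¹ ∫_α^{1-β} (F̂₁⁻¹(u) - F̂₀⁻¹(u)) du`. -/
def trimmedMeanDiff (α β : ℝ) (n : ℕ) (d : ℕ → Bool × ℝ) : ℝ :=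
  1 / (1 - (α + β)) * ∫ u in α..(1 - β),
    (quantile (empiricalCDF true n d) u - quantile (empiricalCDF false n d) u)

/-! ### The constant additive treatment effect model and its information bound -/

/-- Counting measure times Lebesgue measure, which dominates all laws of `(Z, Y)`. -/
def baseMeasure : Measure (Bool × ℝ) := (Measure.count : Measure Bool).prod volume

/-- The density of an observation `(Z, Y)` when `Z` is Bernoulli `p`, `Y` given `Z = 0` has density
`f`, and `Y` given `Z = 1` has density `f(· - τ)`. -/
def additiveDensity (p : ℝ) (f : ℝ → ℝ) (τ : ℝ) (w : Bool × ℝ) : ℝ :=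
  if w.1 = true then p * f (w.2 - τ) else (1 - p) * f w.2

/-- The law of an observation `(Z, Y)` in the constant additive treatment effect model. -/
def additiveLaw (p : ℝ) (f : ℝ → ℝ) (τ : ℝ) : Measure (Bool × ℝ) :=
  baseMeasure.withDensity fun w => ENNReal.ofReal (additiveDensity p f τ w)

/-- A regular one-dimensional submodel `t ↦ (f t, τ t)`, passing through `(f₀, τ₀)` at `t = 0`, of
the constant additive treatment effect model in which the control density is an unknown regular
density: the effect `τ t` is differentiable at `0` with derivative `τ'`, and the laws are
differentiable in quadratic mean at `0` with score `g`. -/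
structure IsRegularSubmodel (p : ℝ) (f₀ : ℝ → ℝ) (τ₀ : ℝ) (f : ℝ → ℝ → ℝ) (τ : ℝ → ℝ)
    (τ' : ℝ) (g : Bool × ℝ → ℝ) : Prop where
  regular : ∀ t, IsRegularDensity (f t)
  density_zero : f 0 = f₀
  effect_zero : τ 0 = τ₀
  effect_deriv : HasDerivAt τ τ' 0
  score_memLp : MemLp g 2 (additiveLaw p f₀ τ₀)
  quadratic_mean : Tendsto (fun t : ℝ => eLpNorm (fun w =>
      (√(additiveDensity p (f t) (τ t) w) - √(additiveDensity p f₀ τ₀ w)) / t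
        - g w * √(additiveDensity p f₀ τ₀ w) / 2) 2 baseMeasure) (𝓝[≠] 0) (𝓝 0)

/-- The Cramér–Rao bounds `(τ')² / E[g²]` for the effect over the regular one-dimensional submodels
with positive information. -/
def cramerRaoBounds (p : ℝ) (f₀ : ℝ → ℝ) (τ₀ : ℝ) : Set ℝ :=
  {v | ∃ f τ τ' g, IsRegularSubmodel p f₀ τ₀ f τ τ' g ∧
    0 < ∫ w, g w ^ 2 ∂(additiveLaw p f₀ τ₀) ∧
    v = τ' ^ 2 / ∫ w, g w ^ 2 ∂(additiveLaw p f₀ τ₀)}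

/-- `v` is the semiparametric information bound for the effect at `(f₀, τ₀)`: the supremum of the
Cramér–Rao bounds over the regular one-dimensional submodels. -/
def IsInformationBound (p : ℝ) (f₀ : ℝ → ℝ) (τ₀ v : ℝ) : Prop :=
  IsLUB (cramerRaoBounds p f₀ τ₀) v

/-- The scores at `(f₀, τ₀)` of the regular one-dimensional submodels. -/
def scores (p : ℝ) (f₀ : ℝ → ℝ) (τ₀ : ℝ) : Set (Bool × ℝ → ℝ) :=
  {g | ∃ f τ τ', IsRegularSubmodel p f₀ τ₀ f τ τ' g}

/-- `ψ` is the efficient influence function for the effect at `(f₀, τ₀)`: it has mean zero and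
finite variance, it represents the derivative of the effect along every regular submodel, and it
belongs to the tangent space, the `L²`-closed linear span of the scores. -/
structure IsEfficientInfluenceFunction (p : ℝ) (f₀ : ℝ → ℝ) (τ₀ : ℝ) (ψ : Bool × ℝ → ℝ) :
    Prop where
  memLp : MemLp ψ 2 (additiveLaw p f₀ τ₀)
  mean_zero : ∫ w, ψ w ∂(additiveLaw p f₀ τ₀) = 0
  gradient : ∀ f τ τ' g, IsRegularSubmodel p f₀ τ₀ f τ τ' g →
    τ' = ∫ w, ψ w * g w ∂(additiveLaw p f₀ τ₀)
  tangent : ∀ ε : ENNReal, 0 < ε → ∃ g ∈ Submodule.span ℝ (scores p f₀ τ₀),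
    eLpNorm (ψ - g) 2 (additiveLaw p f₀ τ₀) ≤ ε

/-- The estimators `T n`, based on the first `n` observations of the sample `D`, are semiparametrically
efficient for the effect at `(f₀, τ₀)`: they are asymptotically linear, and their
influence function is the efficient one. -/
def IsEfficientEstimator {Ω : Type*} [MeasurableSpace Ω] (P : Measure Ω) (D : ℕ → Ω → Bool × ℝ)
    (T : (n : ℕ) → (ℕ → Bool × ℝ) → ℝ) (p : ℝ) (f₀ : ℝ → ℝ) (τ₀ : ℝ) : Prop :=
  ∃ ψ : Bool × ℝ → ℝ, IsEfficientInfluenceFunction p f₀ τ₀ ψ ∧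
    TendstoInMeasure P
      (fun (n : ℕ) ω => √(n : ℝ) * (T n (fun i => D i ω) - τ₀)
        - (∑ i ∈ Finset.range n, ψ (D i ω)) / √(n : ℝ))
      atTop (fun _ => (0 : ℝ))

end

/-! ### The extended Huber density -/

/-! Put `a = μ - σ k₁` and `b = μ + σ k₂`. The location score of the extended Huber density is `S x
= -(clip x - μ) / σ²`, where `clip` truncates to `[a, b]`. Everything rests on this: the score is,
up to an affine change, the function whose sample mean the trimmed mean approximates.

Fisher information: `S` has slope `-1/σ²` on `(a, b)` and is constant outside. Integrating `(S f)' =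
S' f + S² f` therefore gives `I = F(a, b] / σ² = (1 - α - β) / σ²` (`fisherInfo_eq_mul_integral`).

Information bound: this part uses only that `f` is positive with a bounded Lipschitz score. Along
any regular submodel, pair the difference quotients of the root densities of the two arms with `S
√f`, the treated arm being translated back by `τ`. After subtraction, a change of variables moves
the effect shift onto `S √f`. The nuisance path then enters only through its `L²` limit `√f`, and
what remains is `∫ S (g₁ - g₀) f = -τ' I` (`integral_score_slices`). Hence `ψ`, equal to `-S(y -
τ)/(pI)` on the treated arm and `S(y)/((1-p)I)` on the control arm, represents the derivative of the
effect. It is itself the score of a submodel of location shifts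
(`isRegularSubmodel_additiveInfluence`), so it lies in the tangent space, and Cauchy–Schwarz gives a
bound `E ψ² = 1/(p(1-p)I)` that is attained.

Estimator: integrating a quantile function over `[α, γ]` differs from the clipped mean (minus
constants) by at most two products of a quantile error and a distribution function error
(`abs_integral_quantile_sub_le`). For the empirical measure of an arm, the second factor times `√n`
is bounded in probability and the first tends to zero almost surely, so no rate for the quantiles is
needed (`tendstoInMeasure_integral_quantile`). The clipped mean being an affine function of the mean
score, the trimmed mean difference has influence function exactly `ψ`. The central limit theorem and
Slutsky's lemma then give the limit law. -/

theorem hasDerivAt_sq_max_zero (x : ℝ) :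
    HasDerivAt (fun y : ℝ => max y 0 ^ 2) (2 * max x 0) x := by
  rw [hasDerivAt_iff_isLittleO]
  -- The first-order error is at most `(y - x)²` for every combination of signs, so the kink at `0`
  -- needs no separate treatment.
  have h : (fun y : ℝ => max y 0 ^ 2 - max x 0 ^ 2 - (y - x) • (2 * max x 0))
      =O[𝓝 x] fun y => (y - x) ^ 2 := by
    refine Asymptotics.IsBigO.of_bound 1 (Eventually.of_forall fun y => ?_)
    rw [one_mul, Real.norm_eq_abs, Real.norm_eq_abs, abs_of_nonneg (sq_nonneg (y - x)), smul_eq_mul,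
      abs_le]
    rcases le_total x 0 with hx | hx <;> rcases le_total y 0 with hy | hy <;>
      simp only [hx, hy, max_eq_left, max_eq_right] <;> constructor <;> nlinarith
  refine h.trans_isLittleO ?_
  have := (Asymptotics.isLittleO_pow_id (𝕜 := ℝ) (n := 2) one_lt_two)
  exact this.comp_tendsto (k := fun y => y - x) (by
    have : Tendsto (fun y => y - x) (𝓝 x) (𝓝 (x - x)) := (continuous_id.sub continuous_const).tendsto x
    simpa using this)

/-- The location score of the extended Huber density. -/
noncomputable def huberScore (k₁ k₂ μ σ x : ℝ) : ℝ := -max (-k₁) (min k₂ ((x - μ) / σ)) / σ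

/-- Squared positive parts turn the three branches into one sum of differentiable functions, so the
junctions `-k₁` and `k₂` need no one-sided derivatives. -/
theorem huberLogDensity_eq {k₁ k₂ : ℝ} (hk₁ : 0 < k₁) (hk₂ : 0 < k₂) (x : ℝ) :
    huberLogDensity k₁ k₂ x = -x ^ 2 / 2 + max (x - k₂) 0 ^ 2 / 2 + max (-k₁ - x) 0 ^ 2 / 2
      - huberLogConst k₁ k₂ := by
  unfold huberLogDensity
  split_ifs with h1 h2
  · rw [max_eq_right (by linarith), max_eq_left (by linarith)]; ring
  · rw [max_eq_right (by linarith), max_eq_right (by linarith)]; ring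
  · rw [max_eq_left (by linarith), max_eq_right (by linarith)]; ring

theorem hasDerivAt_huberLogDensity {k₁ k₂ : ℝ} (hk₁ : 0 < k₁) (hk₂ : 0 < k₂) (x : ℝ) :
    HasDerivAt (huberLogDensity k₁ k₂) (-max (-k₁) (min k₂ x)) x := by
  have h2 : HasDerivAt (fun x : ℝ => max (x - k₂) 0 ^ 2 / 2) (max (x - k₂) 0) x := by
    have := ((hasDerivAt_sq_max_zero (x - k₂)).comp x ((hasDerivAt_id x).sub_const k₂)).div_const 2
    simpa [Function.comp_def] using this
  have h1 : HasDerivAt (fun x : ℝ => max (-k₁ - x) 0 ^ 2 / 2) (-max (-k₁ - x) 0) x := by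
    have := ((hasDerivAt_sq_max_zero (-k₁ - x)).comp x
      ((hasDerivAt_id x).const_sub (-k₁))).div_const 2
    exact this.congr_deriv (by ring)
  have h0 : HasDerivAt (fun x : ℝ => -x ^ 2 / 2) (-x) x := by
    have := ((hasDerivAt_pow 2 x).neg).div_const 2
    exact this.congr_deriv (by push_cast; ring)
  rw [funext (huberLogDensity_eq hk₁ hk₂)]
  refine (((h0.add h2).add h1).sub_const (huberLogConst k₁ k₂)).congr_deriv ?_
  rcases le_total x k₂ with hx | hx
  · rw [min_eq_right hx, max_eq_right (a := x - k₂) (by linarith)]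
    rcases le_total x (-k₁) with hx' | hx'
    · rw [max_eq_left hx', max_eq_left (by linarith)]; ring
    · rw [max_eq_right hx', max_eq_right (by linarith)]; ring
  · rw [min_eq_left hx, max_eq_left (a := x - k₂) (by linarith), max_eq_right (by linarith),
      max_eq_right (by linarith)]
    ring

/-- Identifies the Gaussian summand of the normalizing constant with the integral of the
unnormalized middle piece. -/
theorem stdNormalCDF_sub {a b : ℝ} (hab : a ≤ b) :
    √(2 * Real.pi) * (stdNormalCDF b - stdNormalCDF a) = ∫ x in Set.Ioc a b, Real.exp (-x ^ 2 / 2) := by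
  have h : stdNormalCDF b - stdNormalCDF a = (gaussianReal 0 1).real (Set.Ioc a b) := by
    unfold stdNormalCDF
    rw [← measureReal_sdiff (Set.Iic_subset_Iic.2 hab) measurableSet_Iic]
    congr 1
    ext x; simp [and_comm]
  rw [h, measureReal_def, gaussianReal_apply_eq_integral _ one_ne_zero, ENNReal.toReal_ofReal
    (integral_nonneg fun x => gaussianPDFReal_nonneg _ _ _), ← integral_const_mul]
  refine integral_congr_ae (Eventually.of_forall fun x => ?_)
  have : √(2 * Real.pi) ≠ 0 := by positivity
  simp only [gaussianPDFReal, NNReal.coe_one, mul_one, sub_zero]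
  field_simp

/-- Up to the common factor `exp (-c)`, the left tail, the right tail and the middle piece integrate
to the three summands inside the logarithm of `huberLogConst`. -/
theorem integrable_exp_huberLogDensity {k₁ k₂ : ℝ} (hk₁ : 0 < k₁) (hk₂ : 0 < k₂) :
    Integrable (fun x => Real.exp (huberLogDensity k₁ k₂ x)) ∧
      ∫ x, Real.exp (huberLogDensity k₁ k₂ x) = 1 := by
  set C := huberLogConst k₁ k₂ with hC
  have hcont : Continuous fun x => Real.exp (huberLogDensity k₁ k₂ x) :=
    Real.continuous_exp.comp (continuous_iff_continuousAt.2 fun x =>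
      (hasDerivAt_huberLogDensity hk₁ hk₂ x).continuousAt)
  have e1 : Set.EqOn (fun x => Real.exp (huberLogDensity k₁ k₂ x))
      (fun x => Real.exp (k₁ * x) * Real.exp (k₁ ^ 2 / 2 - C)) (Set.Iic (-k₁)) := by
    intro x (hx : x ≤ -k₁)
    simp only [huberLogDensity_eq hk₁ hk₂, ← Real.exp_add]
    rw [max_eq_right (a := x - k₂) (by linarith), max_eq_left (by linarith)]
    congr 1; ring
  have e2 : Set.EqOn (fun x => Real.exp (huberLogDensity k₁ k₂ x))
      (fun x => Real.exp (-x ^ 2 / 2) * Real.exp (-C)) (Set.Ioc (-k₁) k₂) := by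
    intro x hx
    simp only [huberLogDensity_eq hk₁ hk₂, ← Real.exp_add]
    rw [max_eq_right (a := x - k₂) (by linarith [hx.2]), max_eq_right (by linarith [hx.1])]
    congr 1; ring
  have e3 : Set.EqOn (fun x => Real.exp (huberLogDensity k₁ k₂ x))
      (fun x => Real.exp (-k₂ * x) * Real.exp (k₂ ^ 2 / 2 - C)) (Set.Ioi k₂) := by
    intro x (hx : k₂ < x)
    simp only [huberLogDensity_eq hk₁ hk₂, ← Real.exp_add]
    rw [max_eq_left (a := x - k₂) (by linarith), max_eq_right (by linarith)]
    congr 1; ring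
  have i1 : IntegrableOn (fun x => Real.exp (huberLogDensity k₁ k₂ x)) (Set.Iic (-k₁)) :=
    IntegrableOn.congr_fun ((integrableOn_exp_mul_Iic hk₁ _).mul_const _) e1.symm measurableSet_Iic
  have i2 : IntegrableOn (fun x => Real.exp (huberLogDensity k₁ k₂ x)) (Set.Ioc (-k₁) k₂) :=
    (hcont.integrableOn_Icc).mono_set Set.Ioc_subset_Icc_self
  have i3 : IntegrableOn (fun x => Real.exp (huberLogDensity k₁ k₂ x)) (Set.Ioi k₂) :=
    IntegrableOn.congr_fun ((integrableOn_exp_mul_Ioi (neg_lt_zero.2 hk₂) _).mul_const _) e3.symm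
      measurableSet_Ioi
  have hle : -k₁ ≤ k₂ := by linarith
  have i12 : IntegrableOn (fun x => Real.exp (huberLogDensity k₁ k₂ x)) (Set.Iic k₂) := by
    rw [← Set.Iic_union_Ioc_eq_Iic hle]; exact i1.union i2
  have hI : Integrable (fun x => Real.exp (huberLogDensity k₁ k₂ x)) := by
    rw [← integrableOn_univ, ← Set.Iic_union_Ioi (a := k₂)]; exact i12.union i3
  refine ⟨hI, ?_⟩
  rw [← setIntegral_univ, ← Set.Iic_union_Ioi (a := k₂),
    setIntegral_union (Set.Iic_disjoint_Ioi le_rfl) measurableSet_Ioi i12 i3,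
    ← Set.Iic_union_Ioc_eq_Iic hle,
    setIntegral_union (Set.Iic_disjoint_Ioc le_rfl) measurableSet_Ioc i1 i2,
    setIntegral_congr_fun measurableSet_Iic e1, setIntegral_congr_fun measurableSet_Ioc e2,
    setIntegral_congr_fun measurableSet_Ioi e3, integral_mul_const, integral_mul_const,
    integral_mul_const, integral_exp_mul_Iic hk₁, integral_exp_mul_Ioi (neg_lt_zero.2 hk₂),
    ← stdNormalCDF_sub hle]
  set A := Real.exp (-k₁ ^ 2 / 2) / k₁ + Real.exp (-k₂ ^ 2 / 2) / k₂
    + √(2 * Real.pi) * (stdNormalCDF k₂ - stdNormalCDF (-k₁)) with hA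
  have hA0 : 0 < A := by
    have : 0 ≤ √(2 * Real.pi) * (stdNormalCDF k₂ - stdNormalCDF (-k₁)) := by
      rw [stdNormalCDF_sub hle]
      exact setIntegral_nonneg measurableSet_Ioc fun x _ => (Real.exp_pos _).le
    positivity
  have hCA : Real.exp (-C) = A⁻¹ := by
    rw [hC, Real.exp_neg, huberLogConst, Real.exp_log hA0]
  have t1 : Real.exp (k₁ * -k₁) / k₁ * Real.exp (k₁ ^ 2 / 2 - C)
      = Real.exp (-k₁ ^ 2 / 2) / k₁ * Real.exp (-C) := by
    rw [div_mul_eq_mul_div, div_mul_eq_mul_div, ← Real.exp_add, ← Real.exp_add]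
    congr 2; ring
  have t3 : -Real.exp (-k₂ * k₂) / -k₂ * Real.exp (k₂ ^ 2 / 2 - C)
      = Real.exp (-k₂ ^ 2 / 2) / k₂ * Real.exp (-C) := by
    rw [neg_div_neg_eq, div_mul_eq_mul_div, div_mul_eq_mul_div, ← Real.exp_add, ← Real.exp_add]
    congr 2; ring
  rw [t1, t3, ← add_mul, ← add_mul, hCA]
  rw [show Real.exp (-k₁ ^ 2 / 2) / k₁ + √(2 * Real.pi) * (stdNormalCDF k₂ - stdNormalCDF (-k₁))
    + Real.exp (-k₂ ^ 2 / 2) / k₂ = A by rw [hA]; ring]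
  exact mul_inv_cancel₀ hA0.ne'

/-- `f` is a positive probability density whose location score `S` is bounded by `K` and
`K`-Lipschitz. -/
structure HasLipschitzScore (f S : ℝ → ℝ) (K : ℝ) : Prop where
  pos : ∀ x, 0 < f x
  integrable : Integrable f
  integral_eq_one : ∫ x, f x = 1
  hasDerivAt : ∀ x, HasDerivAt f (S x * f x) x
  bound : ∀ x, |S x| ≤ K
  lipschitz : ∀ x y, |S x - S y| ≤ K * |x - y|

section Huber

variable {k₁ k₂ μ σ : ℝ}

/-- Undoing the standardization puts the kinks at the trimming points `μ - σ k₁` and `μ + σ k₂`.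
This form links the score to the trimmed mean. -/
theorem huberScore_eq_clip (hσ : 0 < σ) (x : ℝ) :
    huberScore k₁ k₂ μ σ x
      = -(max (μ - σ * k₁) (min (μ + σ * k₂) x) - μ) / σ ^ 2 := by
  have h : max (μ - σ * k₁) (min (μ + σ * k₂) x)
      = σ * max (-k₁) (min k₂ ((x - μ) / σ)) + μ := by
    rw [mul_max_of_nonneg _ _ hσ.le, mul_min_of_nonneg _ _ hσ.le, max_add, min_add,
      mul_div_cancel₀ _ hσ.ne']
    congr 1
    · ring
    · congr 1 <;> ring
  rw [h, huberScore]
  field_simp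
  ring

/-- A single constant serves as bound and as Lipschitz constant: the clipped value is at most `max
k₁ k₂` before division by `σ`, while clipping is 1-Lipschitz and the two divisions by `σ` give slope
`1 / σ²`. -/
theorem huberDensity_hasLipschitzScore (hk₁ : 0 < k₁) (hk₂ : 0 < k₂) (hσ : 0 < σ) :
    HasLipschitzScore (huberDensity k₁ k₂ μ σ) (huberScore k₁ k₂ μ σ)
      (max (max k₁ k₂ / σ) (1 / σ ^ 2)) where
  pos x := by unfold huberDensity; positivity
  integrable := by
    have := ((integrable_exp_huberLogDensity hk₁ hk₂).1.comp_div hσ.ne').comp_sub_right μ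
    exact this.const_mul σ⁻¹
  integral_eq_one := by
    unfold huberDensity
    rw [integral_const_mul,
      integral_sub_right_eq_self (fun x => Real.exp (huberLogDensity k₁ k₂ (x / σ))) μ,
      Measure.integral_comp_div (fun x => Real.exp (huberLogDensity k₁ k₂ x)),
      (integrable_exp_huberLogDensity hk₁ hk₂).2, abs_of_pos hσ, smul_eq_mul, mul_one,
      inv_mul_cancel₀ hσ.ne']
  hasDerivAt x := by
    have h := (hasDerivAt_huberLogDensity hk₁ hk₂ ((x - μ) / σ)).comp x
      (((hasDerivAt_id x).sub_const μ).div_const σ)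
    have := (h.exp).const_mul σ⁻¹
    refine this.congr_deriv ?_
    simp only [huberScore, huberDensity, Function.comp, id]
    ring
  bound x := by
    refine le_trans ?_ (le_max_left _ _)
    rw [huberScore, abs_div, abs_of_pos hσ, abs_neg]
    gcongr
    rw [abs_le]
    constructor
    · exact (neg_le_neg (le_max_left k₁ k₂)).trans (le_max_left _ _)
    · exact max_le (by linarith [le_max_left k₁ k₂]) ((min_le_left _ _).trans (le_max_right _ _))
  lipschitz x y := by
    have h1 : |huberScore k₁ k₂ μ σ x - huberScore k₁ k₂ μ σ y| ≤ 1 / σ ^ 2 * |x - y| := by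
      rw [huberScore, huberScore, ← sub_div, abs_div, abs_of_pos hσ, neg_sub_neg]
      have : |max (-k₁) (min k₂ ((y - μ) / σ)) - max (-k₁) (min k₂ ((x - μ) / σ))|
          ≤ |(y - μ) / σ - (x - μ) / σ| := by
        have h1 := abs_max_sub_max_le_max (-k₁) (min k₂ ((y - μ) / σ)) (-k₁)
          (min k₂ ((x - μ) / σ))
        have h2 := abs_min_sub_min_le_max k₂ ((y - μ) / σ) k₂ ((x - μ) / σ)
        rw [sub_self, abs_zero, max_eq_right (a := (0 : ℝ)) (abs_nonneg _)] at h1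
        rw [sub_self, abs_zero, max_eq_right (a := (0 : ℝ)) (abs_nonneg _)] at h2
        exact h1.trans h2
      rw [← sub_div, abs_div, abs_of_pos hσ, sub_sub_sub_cancel_right, abs_sub_comm y x] at this
      calc _ ≤ (|x - y| / σ) / σ := by gcongr
        _ = _ := by field_simp
    exact h1.trans (by gcongr; exact le_max_right _ _)

end Huber

/-! ### Integrability, tails and Fisher information for a bounded Lipschitz score -/

namespace HasLipschitzScore

variable {f S : ℝ → ℝ} {K : ℝ}

theorem continuous_score (h : HasLipschitzScore f S K) : Continuous S :=
  (LipschitzWith.of_dist_le' (K := K) fun x y => h.lipschitz x y).continuous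

theorem continuous (h : HasLipschitzScore f S K) : Continuous f :=
  continuous_iff_continuousAt.2 fun x => (h.hasDerivAt x).continuousAt

theorem nonneg_bound (h : HasLipschitzScore f S K) : 0 ≤ K := (abs_nonneg _).trans (h.bound 0)

theorem locationScore_eq (h : HasLipschitzScore f S K) (x : ℝ) : locationScore f x = S x := by
  rw [locationScore, (h.hasDerivAt x).deriv, mul_div_assoc, div_self (h.pos x).ne', mul_one]

theorem integrable_bounded_mul (h : HasLipschitzScore f S K) {g : ℝ → ℝ} {C : ℝ}
    (hg : AEStronglyMeasurable g) (hC : ∀ x, |g x| ≤ C) : Integrable fun x => g x * f x :=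
  h.integrable.bdd_mul (c := C) hg (Eventually.of_forall hC)

theorem integrable_score_mul (h : HasLipschitzScore f S K) : Integrable fun x => S x * f x :=
  h.integrable_bounded_mul h.continuous_score.aestronglyMeasurable h.bound

theorem integrable_score_sq_mul (h : HasLipschitzScore f S K) :
    Integrable fun x => S x ^ 2 * f x :=
  h.integrable_bounded_mul (C := K ^ 2) (h.continuous_score.pow 2).aestronglyMeasurable fun x => by
    rw [abs_pow]; exact pow_le_pow_left₀ (abs_nonneg _) (h.bound x) 2

theorem fisherInfo_eq (h : HasLipschitzScore f S K) : fisherInfo f = ∫ x, S x ^ 2 * f x := by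
  simp only [fisherInfo, h.locationScore_eq]

theorem integral_score_mul (h : HasLipschitzScore f S K) : ∫ x, S x * f x = 0 :=
  integral_eq_zero_of_hasDerivAt_of_integrable h.hasDerivAt h.integrable_score_mul h.integrable

theorem tendsto_atTop (h : HasLipschitzScore f S K) : Tendsto f atTop (𝓝 0) :=
  tendsto_zero_of_hasDerivAt_of_integrableOn_Ioi (a := 0) (fun x _ => h.hasDerivAt x)
    h.integrable_score_mul.integrableOn h.integrable.integrableOn

theorem tendsto_atBot (h : HasLipschitzScore f S K) : Tendsto f atBot (𝓝 0) :=
  tendsto_zero_of_hasDerivAt_of_integrableOn_Iic (a := 0) (fun x _ => h.hasDerivAt x)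
    h.integrable_score_mul.integrableOn h.integrable.integrableOn

/-- Kills the boundary terms at `±∞` in the integration by parts for the Fisher information. -/
theorem tendsto_score_mul (h : HasLipschitzScore f S K) {l : Filter ℝ} (hl : Tendsto f l (𝓝 0)) :
    Tendsto (fun x => S x * f x) l (𝓝 0) := by
  refine squeeze_zero_norm (a := fun x => K * f x) (fun x => ?_) (by simpa using hl.const_mul K)
  rw [norm_mul, Real.norm_of_nonneg (h.pos x).le]
  exact mul_le_mul_of_nonneg_right (h.bound x) (h.pos x).le

/-- Integration by parts: if `S` is constant outside of `(a, b)` and has derivative `-c` inside,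
then the Fisher information is `c` times the probability of `(a, b]`. -/
theorem fisherInfo_eq_mul_integral (h : HasLipschitzScore f S K) {a b c : ℝ} (hab : a ≤ b)
    (ha : ∀ x < a, HasDerivAt S 0 x) (hb : ∀ x, b < x → HasDerivAt S 0 x)
    (hc : ∀ x ∈ Set.Ioo a b, HasDerivAt S (-c) x) :
    fisherInfo f = c * ∫ x in Set.Ioc a b, f x := by
  have hcont : Continuous fun x => S x * f x := h.continuous_score.mul h.continuous
  have hI := h.integrable_score_sq_mul
  -- As `(S f)' = S' f + S² f`, the function `S f` is a primitive of `S² f` on the two tails and of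
  -- `S² f - c f` on `(a, b)`. The boundary values at `a` and `b` cancel in the sum.
  have e1 : ∫ x in Set.Iic a, S x ^ 2 * f x = S a * f a - 0 :=
    integral_Iic_of_hasDerivAt_of_tendsto (f := fun x => S x * f x)
      hcont.continuousWithinAt
      (fun x hx => ((ha x hx).mul (h.hasDerivAt x)).congr_deriv (by ring)) hI.integrableOn
      (h.tendsto_score_mul h.tendsto_atBot)
  have e3 : ∫ x in Set.Ioi b, S x ^ 2 * f x = 0 - S b * f b :=
    integral_Ioi_of_hasDerivAt_of_tendsto (f := fun x => S x * f x)
      hcont.continuousWithinAt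
      (fun x hx => ((hb x hx).mul (h.hasDerivAt x)).congr_deriv (by ring)) hI.integrableOn
      (h.tendsto_score_mul h.tendsto_atTop)
  have e2 : ∫ x in a..b, (S x ^ 2 * f x - c * f x) = S b * f b - S a * f a :=
    intervalIntegral.integral_eq_sub_of_hasDerivAt_of_le (f := fun x => S x * f x) hab
      hcont.continuousOn
      (fun x hx => ((hc x hx).mul (h.hasDerivAt x)).congr_deriv (by ring))
      (hI.sub (h.integrable.const_mul c)).intervalIntegrable
  rw [intervalIntegral.integral_of_le hab, integral_sub hI.integrableOn
    (h.integrable.const_mul c).integrableOn, integral_const_mul] at e2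
  rw [h.fisherInfo_eq, ← setIntegral_univ, ← Set.Iic_union_Ioi (a := b),
    setIntegral_union (Set.Iic_disjoint_Ioi le_rfl) measurableSet_Ioi hI.integrableOn
      hI.integrableOn, ← Set.Iic_union_Ioc_eq_Iic hab,
    setIntegral_union (Set.Iic_disjoint_Ioc le_rfl) measurableSet_Ioc hI.integrableOn
      hI.integrableOn]
  linarith

theorem densityMeasure_real (h : HasLipschitzScore f S K) {s : Set ℝ} (hs : MeasurableSet s) :
    (densityMeasure f).real s = ∫ x in s, f x := by
  rw [measureReal_def, densityMeasure, withDensity_apply _ hs,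
    integral_eq_lintegral_of_nonneg_ae (Eventually.of_forall fun x => (h.pos x).le)
      h.continuous.aestronglyMeasurable]

theorem isProbabilityMeasure (h : HasLipschitzScore f S K) :
    IsProbabilityMeasure (densityMeasure f) := by
  constructor
  rw [densityMeasure, withDensity_apply _ MeasurableSet.univ, Measure.restrict_univ,
    ← ofReal_integral_eq_lintegral_ofReal h.integrable
      (Eventually.of_forall fun x => (h.pos x).le), h.integral_eq_one, ENNReal.ofReal_one]

theorem setIntegral_pos (h : HasLipschitzScore f S K) {s : Set ℝ} (hs : volume s ≠ 0) :
    0 < ∫ x in s, f x := by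
  rw [setIntegral_pos_iff_support_of_nonneg_ae (Eventually.of_forall fun x => (h.pos x).le)
    h.integrable.integrableOn, Set.inter_eq_right.2]
  · exact pos_iff_ne_zero.2 hs
  · exact fun x _ => (h.pos x).ne'

theorem densityCDF_eq (h : HasLipschitzScore f S K) (x : ℝ) :
    densityCDF f x = ∫ y in Set.Iic x, f y := h.densityMeasure_real measurableSet_Iic

theorem densityCDF_sub (h : HasLipschitzScore f S K) {a b : ℝ} (hab : a ≤ b) :
    densityCDF f b - densityCDF f a = ∫ y in Set.Ioc a b, f y := by
  rw [h.densityCDF_eq, h.densityCDF_eq, ← Set.Iic_union_Ioc_eq_Iic hab,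
    setIntegral_union (Set.Iic_disjoint_Ioc le_rfl) measurableSet_Ioc h.integrable.integrableOn
      h.integrable.integrableOn, add_sub_cancel_left]

theorem densityCDF_strictMono (h : HasLipschitzScore f S K) : StrictMono (densityCDF f) := by
  intro a b hab
  rw [← sub_pos, h.densityCDF_sub hab.le]
  exact h.setIntegral_pos (by simpa using hab)

theorem densityCDF_pos (h : HasLipschitzScore f S K) (x : ℝ) : 0 < densityCDF f x := by
  rw [h.densityCDF_eq]
  exact h.setIntegral_pos (by simp)

theorem densityCDF_lt_one (h : HasLipschitzScore f S K) (x : ℝ) : densityCDF f x < 1 := by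
  have := h.isProbabilityMeasure
  exact (h.densityCDF_strictMono (lt_add_one x)).trans_le measureReal_le_one

end HasLipschitzScore

/-- The clipped form of the score is constant beyond the trimming points and has slope `-1 / σ²`
between them, so the integration by parts applies with `c = 1 / σ ^ 2`. -/
theorem fisherInfo_huberDensity {k₁ k₂ μ σ : ℝ} (hk₁ : 0 < k₁) (hk₂ : 0 < k₂) (hσ : 0 < σ) :
    fisherInfo (huberDensity k₁ k₂ μ σ)
      = (densityCDF (huberDensity k₁ k₂ μ σ) (μ + σ * k₂)
          - densityCDF (huberDensity k₁ k₂ μ σ) (μ - σ * k₁)) / σ ^ 2 := by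
  have h := huberDensity_hasLipschitzScore (μ := μ) hk₁ hk₂ hσ
  have hab : μ - σ * k₁ ≤ μ + σ * k₂ := by nlinarith [mul_pos hσ hk₁, mul_pos hσ hk₂]
  rw [h.densityCDF_sub hab, h.fisherInfo_eq_mul_integral (c := 1 / σ ^ 2) hab]
  · ring
  · intro x hx
    refine (hasDerivAt_const x (-(μ - σ * k₁ - μ) / σ ^ 2)).congr_of_eventuallyEq ?_
    filter_upwards [Iio_mem_nhds hx] with y hy
    rw [huberScore_eq_clip hσ, max_eq_left ((min_le_right _ _).trans hy.le)]
  · intro x hx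
    refine (hasDerivAt_const x (-(μ + σ * k₂ - μ) / σ ^ 2)).congr_of_eventuallyEq ?_
    filter_upwards [Ioi_mem_nhds hx] with y hy
    rw [huberScore_eq_clip hσ, min_eq_left (le_of_lt hy), max_eq_right hab]
  · intro x hx
    have := (((hasDerivAt_id x).sub_const μ).neg).div_const (σ ^ 2)
    refine (this.congr_deriv (by ring)).congr_of_eventuallyEq ?_
    filter_upwards [Ioo_mem_nhds hx.1 hx.2] with y hy
    rw [huberScore_eq_clip hσ, min_eq_right hy.2.le, max_eq_right hy.1.le]
    rfl

/-! ### The laws of an observation -/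

theorem baseMeasure_eq :
    baseMeasure = (volume : Measure ℝ).map (Prod.mk true) + (volume : Measure ℝ).map (Prod.mk false) := by
  have : (Measure.count : Measure Bool) = Measure.dirac true + Measure.dirac false := by
    refine Measure.ext_of_singleton fun b => ?_
    cases b <;> simp
  rw [baseMeasure, this, Measure.add_prod, Measure.dirac_prod, Measure.dirac_prod]

theorem lintegral_baseMeasure (F : Bool × ℝ → ENNReal) :
    ∫⁻ w, F w ∂baseMeasure = (∫⁻ y, F (true, y)) + ∫⁻ y, F (false, y) := by
  rw [baseMeasure_eq, lintegral_add_measure, (measurableEmbedding_prodMk_left true).lintegral_map,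
    (measurableEmbedding_prodMk_left false).lintegral_map]

theorem map_prodMk_le_baseMeasure (z : Bool) :
    (volume : Measure ℝ).map (Prod.mk z) ≤ baseMeasure := by
  rw [baseMeasure_eq]
  cases z
  · exact Measure.le_add_left le_rfl
  · exact Measure.le_add_right le_rfl

theorem eLpNorm_slice_le (F : Bool × ℝ → ℝ) (z : Bool) :
    eLpNorm (fun y => F (z, y)) 2 volume ≤ eLpNorm F 2 baseMeasure :=
  calc eLpNorm (fun y => F (z, y)) 2 volume
      = eLpNorm F 2 ((volume : Measure ℝ).map (Prod.mk z)) :=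
        ((measurableEmbedding_prodMk_left z).eLpNorm_map_measure).symm
    _ ≤ _ := eLpNorm_mono_measure _ (map_prodMk_le_baseMeasure z)

theorem eLpNorm_two_eq {α : Type*} [MeasurableSpace α] (μ : Measure α) (F : α → ℝ) :
    eLpNorm F 2 μ = (∫⁻ x, ‖F x‖ₑ ^ 2 ∂μ) ^ (1 / 2 : ℝ) := by
  rw [eLpNorm_eq_lintegral_rpow_enorm_toReal two_ne_zero ENNReal.ofNat_ne_top]
  simp

theorem tendsto_eLpNorm_two_iff {α ι : Type*} [MeasurableSpace α] {μ : Measure α} {F : ι → α → ℝ}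
    {l : Filter ι} : Tendsto (fun t => eLpNorm (F t) 2 μ) l (𝓝 0) ↔
      Tendsto (fun t => ∫⁻ x, ‖F t x‖ₑ ^ 2 ∂μ) l (𝓝 0) := by
  simp_rw [eLpNorm_two_eq]
  constructor <;> intro h
  · have := ((ENNReal.continuous_rpow_const (y := 2)).tendsto 0).comp h
    simp only [Function.comp_def, ← ENNReal.rpow_mul] at this
    simpa using this
  · have := ((ENNReal.continuous_rpow_const (y := 1 / 2)).tendsto 0).comp h
    simpa [Function.comp_def] using this

theorem tendsto_eLpNorm_baseMeasure {ι : Type*} {l : Filter ι} {F : ι → Bool × ℝ → ℝ}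
    (h : ∀ z, Tendsto (fun t => eLpNorm (fun y => F t (z, y)) 2 volume) l (𝓝 0)) :
    Tendsto (fun t => eLpNorm (F t) 2 baseMeasure) l (𝓝 0) := by
  rw [tendsto_eLpNorm_two_iff]
  simp_rw [lintegral_baseMeasure]
  have h' := fun z => tendsto_eLpNorm_two_iff.1 (h z)
  simpa using (h' true).add (h' false)

theorem integral_densityMeasure {f : ℝ → ℝ} (hf : Continuous f) (h0 : ∀ x, 0 ≤ f x) (g : ℝ → ℝ) :
    ∫ y, g y ∂(densityMeasure f) = ∫ y, g y * f y := by
  rw [densityMeasure, integral_withDensity_eq_integral_toReal_smul hf.measurable.ennreal_ofReal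
    (Eventually.of_forall fun _ => ENNReal.ofReal_lt_top)]
  refine integral_congr_ae (Eventually.of_forall fun y => ?_)
  simp [ENNReal.toReal_ofReal (h0 y), mul_comm]

theorem integrable_densityMeasure_iff {f : ℝ → ℝ} (hf : Continuous f) (h0 : ∀ x, 0 ≤ f x)
    (g : ℝ → ℝ) : Integrable g (densityMeasure f) ↔ Integrable fun y => g y * f y := by
  rw [densityMeasure, integrable_withDensity_iff_integrable_smul' hf.measurable.ennreal_ofReal
    (Eventually.of_forall fun _ => ENNReal.ofReal_lt_top)]
  refine integrable_congr (Eventually.of_forall fun y => ?_)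
  simp [ENNReal.toReal_ofReal (h0 y), mul_comm]

theorem measurable_prodMk_add (τ : ℝ) : Measurable fun y : ℝ => (true, y + τ) :=
  measurable_const.prodMk (measurable_id.add_const τ)

/-- Translation invariance of Lebesgue measure moves the shift of the treated arm from the density
to the map, so that both arms are expressed through the same `f`. -/
theorem additiveLaw_eq {p : ℝ} (hp0 : 0 ≤ p) (hp1 : p ≤ 1) {f : ℝ → ℝ} (hf : Continuous f) (τ : ℝ) :
    additiveLaw p f τ = ENNReal.ofReal p • (densityMeasure f).map (fun y => (true, y + τ))
      + ENNReal.ofReal (1 - p) • (densityMeasure f).map (Prod.mk false) := by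
  ext s hs
  have hm1 : MeasurableSet ((fun y : ℝ => (true, y + τ)) ⁻¹' s) := measurable_prodMk_add τ hs
  have hm0 : MeasurableSet (Prod.mk false ⁻¹' s : Set ℝ) := measurable_prodMk_left hs
  have hfm := hf.measurable.ennreal_ofReal
  rw [additiveLaw, withDensity_apply _ hs, ← lintegral_indicator hs, lintegral_baseMeasure]
  simp only [Measure.coe_add, Measure.coe_smul, Pi.add_apply, Pi.smul_apply, smul_eq_mul]
  rw [Measure.map_apply (measurable_prodMk_add τ) hs, Measure.map_apply measurable_prodMk_left hs,
    densityMeasure, withDensity_apply _ hm1, withDensity_apply _ hm0,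
    ← lintegral_indicator hm1, ← lintegral_indicator hm0,
    ← lintegral_const_mul _ (hfm.indicator hm1), ← lintegral_const_mul _ (hfm.indicator hm0)]
  congr 1
  · rw [← lintegral_add_right_eq_self _ τ]
    refine lintegral_congr fun y => ?_
    by_cases h : (true, y + τ) ∈ s
    · rw [Set.indicator_of_mem h, Set.indicator_of_mem (s := (fun y : ℝ => (true, y + τ)) ⁻¹' s) h]
      simp [additiveDensity, ENNReal.ofReal_mul hp0]
    · rw [Set.indicator_of_notMem h,
        Set.indicator_of_notMem (s := (fun y : ℝ => (true, y + τ)) ⁻¹' s) h, mul_zero]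
  · refine lintegral_congr fun y => ?_
    by_cases h : (false, y) ∈ s
    · rw [Set.indicator_of_mem h, Set.indicator_of_mem (s := (Prod.mk false ⁻¹' s : Set ℝ)) h]
      simp [additiveDensity, ENNReal.ofReal_mul (sub_nonneg.2 hp1)]
    · rw [Set.indicator_of_notMem h,
        Set.indicator_of_notMem (s := (Prod.mk false ⁻¹' s : Set ℝ)) h, mul_zero]

theorem integral_additiveLaw {p : ℝ} (hp0 : 0 < p) (hp1 : p < 1) {f : ℝ → ℝ} (hf : Continuous f)
    (h0 : ∀ x, 0 ≤ f x) (τ : ℝ) {φ : Bool × ℝ → ℝ} (hφ : Integrable φ (additiveLaw p f τ)) :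
    ∫ w, φ w ∂(additiveLaw p f τ)
      = p * (∫ y, φ (true, y + τ) * f y) + (1 - p) * ∫ y, φ (false, y) * f y := by
  have hp : ENNReal.ofReal p ≠ 0 := by simpa using hp0
  have hq : ENNReal.ofReal (1 - p) ≠ 0 := by simpa using hp1
  rw [additiveLaw_eq hp0.le hp1.le hf, integrable_add_measure,
    integrable_smul_measure hp ENNReal.ofReal_ne_top,
    integrable_smul_measure hq ENNReal.ofReal_ne_top] at hφ
  rw [additiveLaw_eq hp0.le hp1.le hf, integral_add_measure (hφ.1.smul_measure ENNReal.ofReal_ne_top)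
    (hφ.2.smul_measure ENNReal.ofReal_ne_top), integral_smul_measure, integral_smul_measure,
    integral_map (measurable_prodMk_add τ).aemeasurable hφ.1.1,
    integral_map measurable_prodMk_left.aemeasurable hφ.2.1, integral_densityMeasure hf h0,
    integral_densityMeasure hf h0, ENNReal.toReal_ofReal hp0.le,
    ENNReal.toReal_ofReal (sub_nonneg.2 hp1.le), smul_eq_mul, smul_eq_mul]

theorem HasLipschitzScore.isProbabilityMeasure_additiveLaw {f S : ℝ → ℝ} {K : ℝ}
    (h : HasLipschitzScore f S K) {p : ℝ} (hp0 : 0 ≤ p) (hp1 : p ≤ 1) (τ : ℝ) :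
    IsProbabilityMeasure (additiveLaw p f τ) := by
  have := h.isProbabilityMeasure
  constructor
  rw [additiveLaw_eq hp0 hp1 h.continuous]
  simp only [Measure.coe_add, Measure.coe_smul, Pi.add_apply, Pi.smul_apply, smul_eq_mul]
  rw [Measure.map_apply (measurable_prodMk_add τ) MeasurableSet.univ,
    Measure.map_apply measurable_prodMk_left MeasurableSet.univ]
  simp only [Set.preimage_univ, measure_univ, mul_one]
  rw [← ENNReal.ofReal_add hp0 (sub_nonneg.2 hp1), add_sub_cancel, ENNReal.ofReal_one]

/-- `u ↦ u √f` is the isometry from `L²(f dx)` to `L²(dx)`. Positivity of `f` makes Lebesgue measure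
absolutely continuous with respect to `f dx`, which transfers measurability. -/
theorem memLp_two_mul_sqrt {f : ℝ → ℝ} (hf : Continuous f) (h0 : ∀ x, 0 < f x) {u : ℝ → ℝ}
    (hu : MemLp u 2 (densityMeasure f)) : MemLp (fun y => u y * √(f y)) 2 volume := by
  have hac : (volume : Measure ℝ) ≪ densityMeasure f :=
    withDensity_absolutelyContinuous' hf.measurable.ennreal_ofReal.aemeasurable
      (Eventually.of_forall fun x => by simpa using h0 x)
  have hm : AEStronglyMeasurable (fun y => u y * √(f y)) volume :=
    (hu.1.mono_ac hac).mul (Real.continuous_sqrt.comp hf).aestronglyMeasurable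
  rw [memLp_two_iff_integrable_sq hm]
  have := (integrable_densityMeasure_iff hf (fun x => (h0 x).le) _).1
    ((memLp_two_iff_integrable_sq hu.1).1 hu)
  refine this.congr (Eventually.of_forall fun y => ?_)
  simp only [mul_pow, Real.sq_sqrt (h0 y).le]

/-- The two slices of a function in `L²` of the law of an observation. -/
theorem MeasureTheory.MemLp.slices {p : ℝ} (hp0 : 0 < p) (hp1 : p < 1) {f : ℝ → ℝ} (hf : Continuous f)
    {τ : ℝ} {g : Bool × ℝ → ℝ} (hg : MemLp g 2 (additiveLaw p f τ)) :
    MemLp (fun y => g (true, y + τ)) 2 (densityMeasure f) ∧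
      MemLp (fun y => g (false, y)) 2 (densityMeasure f) := by
  have hp : ENNReal.ofReal p ≠ 0 := by simpa using hp0
  have hq : ENNReal.ofReal (1 - p) ≠ 0 := by simpa using hp1
  rw [additiveLaw_eq hp0.le hp1.le hf] at hg
  have key : ∀ {c : ENNReal} (ν : Measure (Bool × ℝ)), c ≠ 0 → c ≠ ⊤ → MemLp g 2 (c • ν) →
      MemLp g 2 ν := fun {c} ν hc hc' h =>
    h.of_measure_le_smul (c := c⁻¹) (ENNReal.inv_ne_top.2 hc) (by
      rw [smul_smul, ENNReal.inv_mul_cancel hc hc', one_smul])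
  constructor
  · have h1 := key _ hp ENNReal.ofReal_ne_top
      (hg.mono_measure (Measure.le_add_right (μ := ENNReal.ofReal p •
        (densityMeasure f).map (fun y => (true, y + τ))) le_rfl))
    exact h1.comp_of_map (measurable_prodMk_add τ).aemeasurable
  · have h1 := key _ hq ENNReal.ofReal_ne_top
      (hg.mono_measure (Measure.le_add_left (μ := ENNReal.ofReal (1 - p) •
        (densityMeasure f).map (Prod.mk false)) le_rfl))
    exact h1.comp_of_map measurable_prodMk_left.aemeasurable

/-! ### Weak limits in `L²` -/

/-- Cauchy–Schwarz with extended values, so that `u` need not be known to be square integrable. -/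
theorem abs_integral_mul_le {u v : ℝ → ℝ} (hu : AEStronglyMeasurable u) (hv : MemLp v 2 volume) :
    ENNReal.ofReal |∫ y, u y * v y| ≤ eLpNorm u 2 volume * eLpNorm v 2 volume :=
  calc ENNReal.ofReal |∫ y, u y * v y| = ‖∫ y, u y * v y‖ₑ := (Real.enorm_eq_ofReal_abs _).symm
    _ ≤ ∫⁻ y, ‖u y * v y‖ₑ := enorm_integral_le_lintegral_enorm _
    _ = eLpNorm (u • v) 1 volume := by rw [eLpNorm_one_eq_lintegral_enorm]; rfl
    _ ≤ _ := eLpNorm_smul_le_mul_eLpNorm hv.1 hu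

theorem tendsto_integral_mul_zero {ι : Type*} {l : Filter ι} {X : ι → ℝ → ℝ} {v : ℝ → ℝ}
    (hX : ∀ t, AEStronglyMeasurable (X t)) (hv : MemLp v 2 volume)
    (h : Tendsto (fun t => eLpNorm (X t) 2 volume) l (𝓝 0)) :
    Tendsto (fun t => ∫ y, X t y * v y) l (𝓝 0) := by
  refine (tendsto_zero_iff_abs_tendsto_zero _).2 ?_
  have h1 : Tendsto (fun t => eLpNorm (X t) 2 volume * eLpNorm v 2 volume) l (𝓝 0) := by
    simpa using ENNReal.Tendsto.mul_const h (Or.inr hv.2.ne)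
  have h2 := tendsto_of_tendsto_of_tendsto_of_le_of_le tendsto_const_nhds h1
    (fun _ => zero_le) (fun t => abs_integral_mul_le (hX t) hv)
  have := (ENNReal.tendsto_toReal ENNReal.zero_ne_top).comp h2
  simpa [Function.comp_def, ENNReal.toReal_ofReal (abs_nonneg _)] using this

theorem tendsto_integral_mul {ι : Type*} {l : Filter ι} {X : ι → ℝ → ℝ} {x v : ℝ → ℝ}
    (hX : ∀ t, MemLp (X t) 2 volume) (hx : MemLp x 2 volume) (hv : MemLp v 2 volume)
    (h : Tendsto (fun t => eLpNorm (fun y => X t y - x y) 2 volume) l (𝓝 0)) :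
    Tendsto (fun t => ∫ y, X t y * v y) l (𝓝 (∫ y, x y * v y)) := by
  rw [← tendsto_sub_nhds_zero_iff]
  refine (tendsto_integral_mul_zero (fun t => ((hX t).sub hx).1) hv h).congr fun t => ?_
  refine Eq.trans ?_ (integral_sub ((hX t).integrable_mul hv) (hx.integrable_mul hv))
  exact integral_congr_ae (Eventually.of_forall fun y => sub_mul _ _ _)

/-! ### Differentiability in quadratic mean of location families -/

theorem abs_exp_sub_one_le_mul_exp_abs (u : ℝ) : |Real.exp u - 1| ≤ |u| * Real.exp |u| := by
  have h1 := Real.add_one_le_exp u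
  have h2 := Real.add_one_le_exp (-u)
  have h3 : Real.exp (-u) * Real.exp u = 1 := by rw [← Real.exp_add]; simp
  rcases le_total 0 u with hu | hu
  · rw [abs_of_nonneg hu, abs_of_nonneg (by linarith)]
    nlinarith [Real.exp_pos u]
  · rw [abs_of_nonpos hu, abs_of_nonpos (by linarith [Real.exp_le_one_iff.2 hu])]
    nlinarith [Real.one_le_exp (neg_nonneg.2 hu)]

namespace HasLipschitzScore

variable {f S : ℝ → ℝ} {K : ℝ}

theorem comp_add_const (h : HasLipschitzScore f S K) (c : ℝ) :
    HasLipschitzScore (fun y => f (y + c)) (fun y => S (y + c)) K where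
  pos x := h.pos _
  integrable := h.integrable.comp_add_right c
  integral_eq_one := by rw [integral_add_right_eq_self f c, h.integral_eq_one]
  hasDerivAt x := (h.hasDerivAt (x + c)).comp_add_const x c
  bound x := h.bound _
  lipschitz x y := by simpa using h.lipschitz (x + c) (y + c)

theorem isRegularDensity (h : HasLipschitzScore f S K) (hI : 0 < fisherInfo f) :
    IsRegularDensity f where
  nonneg x := (h.pos x).le
  integrable := h.integrable
  integral_eq_one := h.integral_eq_one
  differentiable x := (h.hasDerivAt x).differentiableAt
  integrable_info := by simpa only [h.locationScore_eq] using h.integrable_score_sq_mul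
  info_pos := hI

theorem fisherInfo_comp_add_const (h : HasLipschitzScore f S K) (c : ℝ) :
    fisherInfo (fun y => f (y + c)) = fisherInfo f := by
  rw [(h.comp_add_const c).fisherInfo_eq, h.fisherInfo_eq,
    integral_add_right_eq_self (fun x => S x ^ 2 * f x) c]

theorem continuous_sqrt (h : HasLipschitzScore f S K) : Continuous fun y => √(f y) :=
  Real.continuous_sqrt.comp h.continuous

theorem memLp_bounded_mul_sqrt (h : HasLipschitzScore f S K) {u : ℝ → ℝ} (hu : Continuous u) {C : ℝ}
    (hC : ∀ x, |u x| ≤ C) : MemLp (fun y => u y * √(f y)) 2 volume := by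
  have := h.isProbabilityMeasure
  exact memLp_two_mul_sqrt h.continuous h.pos
    (MemLp.of_bound hu.aestronglyMeasurable C (Eventually.of_forall hC))

theorem memLp_sqrt (h : HasLipschitzScore f S K) : MemLp (fun y => √(f y)) 2 volume := by
  simpa using h.memLp_bounded_mul_sqrt (u := fun _ => 1) continuous_const (C := 1) (by simp)

theorem memLp_score_mul_sqrt (h : HasLipschitzScore f S K) :
    MemLp (fun y => S y * √(f y)) 2 volume :=
  h.memLp_bounded_mul_sqrt h.continuous_score h.bound

theorem hasDerivAt_sqrt (h : HasLipschitzScore f S K) (y : ℝ) :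
    HasDerivAt (fun y => √(f y)) (S y * √(f y) / 2) y := by
  refine ((h.hasDerivAt y).sqrt (h.pos y).ne').congr_deriv ?_
  have h0 : 0 < √(f y) := Real.sqrt_pos.2 (h.pos y)
  rw [div_eq_div_iff (by positivity) two_ne_zero]
  linear_combination (-2 * S y) * Real.sq_sqrt (h.pos y).le

/-- `S` is the derivative of `log f`, so its bound `K` is a Lipschitz constant of `log f`. -/
theorem abs_log_sub_log_le (h : HasLipschitzScore f S K) (x y : ℝ) :
    |Real.log (f y) - Real.log (f x)| ≤ K * |y - x| := by
  have := Convex.norm_image_sub_le_of_norm_hasDerivWithin_le (f := fun x => Real.log (f x)) (f' := S)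
    (C := K) (s := Set.univ) (x := x) (y := y)
    (fun z _ => (((h.hasDerivAt z).log (h.pos z).ne').congr_deriv
      (by rw [mul_div_assoc, div_self (h.pos z).ne', mul_one])).hasDerivWithinAt)
    (fun z _ => h.bound z) convex_univ trivial trivial
  exact this

/-- Write `√f(y + v) = exp u · √f(y)` with `|u| ≤ K |v|`. The increment is then controlled relative
to `√f(y)`, hence by a fixed square integrable function. -/
theorem abs_sqrt_add_sub_le (h : HasLipschitzScore f S K) (y : ℝ) {v : ℝ} (hv : |v| ≤ 1) :
    |√(f (y + v)) - √(f y)| ≤ K * Real.exp K * |v| * √(f y) := by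
  set u := Real.log (√(f (y + v))) - Real.log (√(f y)) with hu
  have p1 : 0 < √(f (y + v)) := Real.sqrt_pos.2 (h.pos _)
  have p0 : 0 < √(f y) := Real.sqrt_pos.2 (h.pos _)
  have hK := h.nonneg_bound
  have hu' : |u| ≤ K * |v| := by
    have := h.abs_log_sub_log_le y (y + v)
    rw [add_sub_cancel_left] at this
    rw [hu, Real.log_sqrt (h.pos _).le, Real.log_sqrt (h.pos _).le, ← sub_div, abs_div, abs_two]
    have := abs_nonneg (Real.log (f (y + v)) - Real.log (f y))
    linarith
  have hexp : √(f (y + v)) = Real.exp u * √(f y) := by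
    rw [hu, Real.exp_sub, Real.exp_log p1, Real.exp_log p0, div_mul_cancel₀ _ p0.ne']
  rw [hexp, show Real.exp u * √(f y) - √(f y) = (Real.exp u - 1) * √(f y) by ring, abs_mul,
    abs_of_pos p0]
  gcongr
  calc |Real.exp u - 1| ≤ |u| * Real.exp |u| := abs_exp_sub_one_le_mul_exp_abs u
    _ ≤ (K * |v|) * Real.exp K := by
        gcongr
        exact hu'.trans (mul_le_of_le_one_right hK hv)
    _ = _ := by ring

theorem abs_score_mul_sqrt_add_sub_le (h : HasLipschitzScore f S K) :
    ∃ C, 0 ≤ C ∧ ∀ y v, |v| ≤ 1 →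
      |S (y + v) * √(f (y + v)) - S y * √(f y)| ≤ C * |v| * √(f y) := by
  have hK := h.nonneg_bound
  -- Product rule: the first summand comes from the increment of `S`, with `√f(y + v)` compared to
  -- `√f(y)`; the second comes from the increment of `√f`, with `|S| ≤ K`.
  refine ⟨K * (1 + K * Real.exp K) + K * (K * Real.exp K), by positivity, fun y v hv => ?_⟩
  have h1 := h.abs_sqrt_add_sub_le y hv
  have p0 : 0 ≤ √(f y) := Real.sqrt_nonneg _
  have h2 : √(f (y + v)) ≤ (1 + K * Real.exp K) * √(f y) := by
    have e : K * Real.exp K * |v| * √(f y) ≤ K * Real.exp K * 1 * √(f y) := by gcongr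
    have := (abs_le.1 h1).2
    linarith
  have h3 : |S (y + v) - S y| ≤ K * |v| := by simpa using h.lipschitz (y + v) y
  calc |S (y + v) * √(f (y + v)) - S y * √(f y)|
      = |(S (y + v) - S y) * √(f (y + v)) + S y * (√(f (y + v)) - √(f y))| := by ring_nf
    _ ≤ |(S (y + v) - S y) * √(f (y + v))| + |S y * (√(f (y + v)) - √(f y))| := abs_add_le _ _
    _ = |S (y + v) - S y| * √(f (y + v)) + |S y| * |√(f (y + v)) - √(f y)| := by
        rw [abs_mul, abs_mul, abs_of_nonneg (Real.sqrt_nonneg _)]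
    _ ≤ (K * |v|) * ((1 + K * Real.exp K) * √(f y)) + K * (K * Real.exp K * |v| * √(f y)) := by
        gcongr
        exact h.bound y
    _ = _ := by ring

/-- A differentiable path eventually satisfies a linear bound. -/
theorem _root_.HasDerivAt.eventually_abs_le {δ : ℝ → ℝ} {d : ℝ} (hδ : HasDerivAt δ d 0)
    (h0 : δ 0 = 0) : ∀ᶠ t in 𝓝[≠] (0 : ℝ), |δ t| ≤ (|d| + 1) * |t| ∧ |δ t| ≤ 1 := by
  have h1 := (hasDerivAt_iff_tendsto_slope.1 hδ).abs.eventually (Iio_mem_nhds (lt_add_one |d|))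
  have h2 : Tendsto δ (𝓝[≠] 0) (𝓝 0) := by
    have := hδ.continuousAt.tendsto
    rw [h0] at this
    exact this.mono_left nhdsWithin_le_nhds
  have h3 := h2.abs.eventually (Iio_mem_nhds (show |(0 : ℝ)| < 1 by simp))
  filter_upwards [h1, h3, self_mem_nhdsWithin] with t h1 h3 ht
  refine ⟨?_, le_of_lt h3⟩
  have ht' : 0 < |t| := abs_pos.2 ht
  rw [slope_def_field, h0, sub_zero, sub_zero, abs_div] at h1
  exact ((div_lt_iff₀ ht').1 h1).le

/-- Dominated convergence: the integrand tends to zero pointwise because `√f` has derivative `S √f /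
2`, and a multiple of `f` dominates it. A general path `δ` is allowed since the shift will be the
effect along an arbitrary submodel. -/
theorem tendsto_eLpNorm_location (h : HasLipschitzScore f S K) {δ : ℝ → ℝ} {d : ℝ}
    (hδ : HasDerivAt δ d 0) (h0 : δ 0 = 0) :
    Tendsto (fun t : ℝ => eLpNorm (fun y =>
      (√(f (y + δ t)) - √(f y)) / t - d * S y * √(f y) / 2) 2 volume) (𝓝[≠] 0) (𝓝 0) := by
  rw [tendsto_eLpNorm_two_iff]
  have hK := h.nonneg_bound
  -- The first summand bounds the difference quotient of `√f`, using `|δ t| ≤ (|d| + 1) |t|`; the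
  -- second bounds its candidate limit.
  set M := K * Real.exp K * (|d| + 1) + |d| * K with hM
  have hlim := tendsto_lintegral_filter_of_dominated_convergence (μ := (volume : Measure ℝ))
    (l := 𝓝[≠] (0 : ℝ)) (f := fun _ => 0)
    (F := fun t y => ‖(√(f (y + δ t)) - √(f y)) / t - d * S y * √(f y) / 2‖ₑ ^ 2)
    (fun y => ENNReal.ofReal (M ^ 2 * f y)) ?_ ?_ ?_ ?_
  · simpa using hlim
  · refine Eventually.of_forall fun t => ?_
    have c1 := h.continuous_sqrt
    have c2 := h.continuous_score
    have c3 : Continuous fun y => √(f (y + δ t)) := c1.comp (continuous_add_const _)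
    have : Continuous fun y => (√(f (y + δ t)) - √(f y)) / t - d * S y * √(f y) / 2 := by fun_prop
    exact this.measurable.enorm.pow_const 2
  · filter_upwards [hδ.eventually_abs_le h0, self_mem_nhdsWithin] with t ht ht0
    refine Eventually.of_forall fun y => ?_
    have ht' : 0 < |t| := abs_pos.2 ht0
    have p0 : 0 ≤ √(f y) := Real.sqrt_nonneg _
    have b1 : |(√(f (y + δ t)) - √(f y)) / t| ≤ K * Real.exp K * (|d| + 1) * √(f y) := by
      rw [abs_div, div_le_iff₀ ht']
      calc _ ≤ K * Real.exp K * |δ t| * √(f y) := h.abs_sqrt_add_sub_le y ht.2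
        _ ≤ K * Real.exp K * ((|d| + 1) * |t|) * √(f y) := by gcongr; exact ht.1
        _ = _ := by ring
    have b2 : |d * S y * √(f y) / 2| ≤ |d| * K * √(f y) := by
      rw [abs_div, abs_mul, abs_mul, abs_two, abs_of_nonneg p0]
      have : |d| * |S y| * √(f y) ≤ |d| * K * √(f y) := by gcongr; exact h.bound y
      have h' : 0 ≤ |d| * K * √(f y) := by positivity
      linarith
    have b3 : |(√(f (y + δ t)) - √(f y)) / t - d * S y * √(f y) / 2| ≤ M * √(f y) := by
      refine (abs_sub _ _).trans ?_
      rw [hM, add_mul]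
      exact add_le_add b1 b2
    rw [Real.enorm_eq_ofReal_abs, ← ENNReal.ofReal_pow (abs_nonneg _)]
    refine ENNReal.ofReal_le_ofReal ?_
    calc _ ≤ (M * √(f y)) ^ 2 := pow_le_pow_left₀ (abs_nonneg _) b3 2
      _ = _ := by rw [mul_pow, Real.sq_sqrt (h.pos y).le]
  · rw [← ofReal_integral_eq_lintegral_ofReal (h.integrable.const_mul _)
      (Eventually.of_forall fun y => mul_nonneg (sq_nonneg _) (h.pos y).le)]
    exact ENNReal.ofReal_ne_top
  · refine Eventually.of_forall fun y => ?_
    have hd : HasDerivAt (fun t => √(f (y + δ t))) (S y * √(f y) / 2 * d) 0 := by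
      have e : y + δ 0 = y := by rw [h0, add_zero]
      have h1 := h.hasDerivAt_sqrt (y + δ 0)
      have := h1.comp 0 (hδ.const_add y)
      rw [e] at this
      exact this
    have hs := hasDerivAt_iff_tendsto_slope.1 hd
    have hs' : Tendsto (fun t => (√(f (y + δ t)) - √(f y)) / t - d * S y * √(f y) / 2)
        (𝓝[≠] 0) (𝓝 0) := by
      have := hs.sub_const (d * S y * √(f y) / 2)
      rw [show S y * √(f y) / 2 * d - d * S y * √(f y) / 2 = 0 by ring] at this
      refine this.congr fun t => ?_
      rw [slope_def_field, h0, add_zero, sub_zero]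
    have := (ENNReal.continuous_pow 2).continuousAt.tendsto.comp hs'.enorm
    simpa [Function.comp_def] using this

end HasLipschitzScore

/-! ### The efficient influence function -/

/-- The efficient influence function for a constant additive effect, `S` being the location score of
the control density and `I` its Fisher information. -/
noncomputable def additiveInfluence (p : ℝ) (S : ℝ → ℝ) (I τ : ℝ) (w : Bool × ℝ) : ℝ :=
  if w.1 = true then -S (w.2 - τ) / (p * I) else S w.2 / ((1 - p) * I)

theorem eLpNorm_two_const_mul_comp_sub_tendsto {F : ℝ → ℝ → ℝ} {l : Filter ℝ} (c τ : ℝ)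
    (hm : ∀ t, AEStronglyMeasurable (F t) volume)
    (h : Tendsto (fun t => eLpNorm (F t) 2 volume) l (𝓝 0)) :
    Tendsto (fun t => eLpNorm (fun y => c * F t (y - τ)) 2 volume) l (𝓝 0) := by
  have h1 : ∀ t, eLpNorm (fun y => c * F t (y - τ)) 2 volume = ‖c‖ₑ * eLpNorm (F t) 2 volume := by
    intro t
    rw [← eLpNorm_comp_measurePreserving (hm t) (measurePreserving_sub_right volume τ),
      ← eLpNorm_const_smul]
    rfl
  simp_rw [h1]
  simpa using ENNReal.Tendsto.const_mul h (Or.inr enorm_ne_top)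

namespace HasLipschitzScore

variable {f S : ℝ → ℝ} {K p τ : ℝ}

theorem measurable_additiveInfluence (h : HasLipschitzScore f S K) :
    Measurable (additiveInfluence p S (fisherInfo f) τ) := by
  have hS := h.continuous_score.measurable
  unfold additiveInfluence
  refine Measurable.ite (measurable_fst (measurableSet_singleton true)) ?_ ?_ <;> fun_prop

theorem exists_bound_additiveInfluence (h : HasLipschitzScore f S K) :
    ∃ C, ∀ w, |additiveInfluence p S (fisherInfo f) τ w| ≤ C := by
  refine ⟨K / |p * fisherInfo f| + K / |(1 - p) * fisherInfo f|, fun w => ?_⟩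
  have hK := h.nonneg_bound
  unfold additiveInfluence
  split_ifs
  · rw [abs_div, abs_neg]
    exact le_add_of_le_of_nonneg (by gcongr; exact h.bound _) (by positivity)
  · rw [abs_div]
    exact le_add_of_nonneg_of_le (by positivity) (by gcongr; exact h.bound _)

theorem memLp_additiveInfluence (h : HasLipschitzScore f S K) (hp0 : 0 < p) (hp1 : p < 1) :
    MemLp (additiveInfluence p S (fisherInfo f) τ) 2 (additiveLaw p f τ) := by
  have := h.isProbabilityMeasure_additiveLaw hp0.le hp1.le τ
  obtain ⟨C, hC⟩ := h.exists_bound_additiveInfluence (p := p) (τ := τ)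
  exact MemLp.of_bound h.measurable_additiveInfluence.aestronglyMeasurable C
    (Eventually.of_forall hC)

theorem integral_additiveInfluence (h : HasLipschitzScore f S K) (hp0 : 0 < p) (hp1 : p < 1) :
    ∫ w, additiveInfluence p S (fisherInfo f) τ w ∂(additiveLaw p f τ) = 0 := by
  have := h.isProbabilityMeasure_additiveLaw hp0.le hp1.le τ
  rw [integral_additiveLaw hp0 hp1 h.continuous (fun x => (h.pos x).le) τ
    ((h.memLp_additiveInfluence hp0 hp1).integrable one_le_two)]
  simp only [additiveInfluence, if_true, add_sub_cancel_right, Bool.false_eq_true, if_false,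
    neg_div, neg_mul, integral_neg, div_mul_eq_mul_div, integral_div, h.integral_score_mul]
  simp

theorem integral_additiveInfluence_sq (h : HasLipschitzScore f S K) (hp0 : 0 < p) (hp1 : p < 1)
    (hI : 0 < fisherInfo f) :
    ∫ w, additiveInfluence p S (fisherInfo f) τ w ^ 2 ∂(additiveLaw p f τ)
      = 1 / (p * (1 - p) * fisherInfo f) := by
  rw [integral_additiveLaw hp0 hp1 h.continuous (fun x => (h.pos x).le) τ
    (h.memLp_additiveInfluence hp0 hp1).integrable_sq]
  simp only [additiveInfluence, if_true, add_sub_cancel_right, Bool.false_eq_true, if_false,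
    div_pow, neg_sq, div_mul_eq_mul_div, integral_div, ← h.fisherInfo_eq]
  have : 0 < 1 - p := by linarith
  field_simp
  ring

/-- The efficient influence function is the score of a submodel of location shifts. -/
theorem isRegularSubmodel_additiveInfluence (h : HasLipschitzScore f S K) (hp0 : 0 < p) (hp1 : p < 1)
    (hI : 0 < fisherInfo f) :
    IsRegularSubmodel p f τ (fun t y => f (y + 1 / ((1 - p) * fisherInfo f) * t))
      (fun t => τ + 1 / (p * (1 - p) * fisherInfo f) * t) (1 / (p * (1 - p) * fisherInfo f))
      (additiveInfluence p S (fisherInfo f) τ) where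
  regular t := (h.comp_add_const _).isRegularDensity (by rwa [h.fisherInfo_comp_add_const])
  density_zero := by simp
  effect_zero := by simp
  effect_deriv := by
    simpa using ((hasDerivAt_id (0 : ℝ)).const_mul (1 / (p * (1 - p) * fisherInfo f))).const_add τ
  score_memLp := h.memLp_additiveInfluence hp0 hp1
  quadratic_mean := by
    have hq : 0 < 1 - p := by linarith
    refine tendsto_eLpNorm_baseMeasure fun z => ?_
    have key : ∀ d : ℝ, Tendsto (fun t : ℝ => eLpNorm (fun y =>
        (√(f (y + d * t)) - √(f y)) / t - d * S y * √(f y) / 2) 2 volume) (𝓝[≠] 0) (𝓝 0) :=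
      fun d => h.tendsto_eLpNorm_location
        (by simpa using (hasDerivAt_id (0 : ℝ)).const_mul d) (mul_zero d)
    have hm : ∀ d t : ℝ, AEStronglyMeasurable (fun y =>
        (√(f (y + d * t)) - √(f y)) / t - d * S y * √(f y) / 2) volume := by
      intro d t
      have c1 := h.continuous_sqrt
      have c2 := h.continuous_score
      have c3 : Continuous fun y => √(f (y + d * t)) := c1.comp (continuous_add_const _)
      exact Continuous.aestronglyMeasurable (by fun_prop)
    cases z
    · refine (eLpNorm_two_const_mul_comp_sub_tendsto (√(1 - p)) 0 (hm _)
        (key (1 / ((1 - p) * fisherInfo f)))).congr fun t => ?_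
      congr 1
      funext y
      simp only [additiveDensity, additiveInfluence, Bool.false_eq_true, if_false, sub_zero,
        Real.sqrt_mul hq.le]
      ring
    · refine (eLpNorm_two_const_mul_comp_sub_tendsto (√p) τ (hm _)
        (key (-(1 / (p * fisherInfo f))))).congr fun t => ?_
      congr 1
      funext y
      simp only [additiveDensity, additiveInfluence, if_true, Real.sqrt_mul hp0.le]
      -- Since `1/(1-p) - 1/(p(1-p)) = -1/p`, the control shift and the effect combine so that the
      -- treated density moves with velocity `-1/(pI)`. The two rates in the submodel are chosen for
      -- this.
      have e : y - (τ + 1 / (p * (1 - p) * fisherInfo f) * t) + 1 / ((1 - p) * fisherInfo f) * t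
          = y - τ + -(1 / (p * fisherInfo f)) * t := by
        field_simp
        ring
      rw [e]
      ring

end HasLipschitzScore

/-! ### The gradient identity along an arbitrary regular submodel -/

theorem IsRegularDensity.memLp_sqrt {f : ℝ → ℝ} (h : IsRegularDensity f) :
    MemLp (fun y => √(f y)) 2 volume := by
  have hm : AEStronglyMeasurable (fun y => √(f y)) volume :=
    (Real.continuous_sqrt.comp h.differentiable.continuous).aestronglyMeasurable
  rw [memLp_two_iff_integrable_sq hm]
  exact h.integrable.congr (Eventually.of_forall fun y => (Real.sq_sqrt (h.nonneg y)).symm)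

theorem MeasureTheory.MemLp.comp_add_const {u : ℝ → ℝ} (hu : MemLp u 2 volume) (c : ℝ) :
    MemLp (fun y => u (y + c)) 2 volume :=
  hu.comp_measurePreserving (measurePreserving_add_right volume c)

namespace HasLipschitzScore

variable {f S : ℝ → ℝ} {K p τ : ℝ}

/-- The limit of the difference quotients of `⟨r t, S √f⟩` along shifts, when `r t` tends to `√f` in
`L²`. -/
theorem tendsto_integral_mul_shift (h : HasLipschitzScore f S K) {r : ℝ → ℝ → ℝ} {δ : ℝ → ℝ} {d : ℝ}
    (hδ : HasDerivAt δ d 0) (h0 : δ 0 = 0) (hr : ∀ t, MemLp (r t) 2 volume)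
    (hlim : Tendsto (fun t => eLpNorm (fun y => r t y - √(f y)) 2 volume) (𝓝[≠] 0) (𝓝 0)) :
    Tendsto (fun t => ∫ y, r t y * ((S (y + δ t) * √(f (y + δ t)) - S y * √(f y)) / t))
      (𝓝[≠] 0) (𝓝 (-d * fisherInfo f / 2)) := by
  set H : ℝ → ℝ := fun y => S y * √(f y) with hH
  have hHm : MemLp H 2 volume := h.memLp_score_mul_sqrt
  have hs := h.memLp_sqrt
  have hQ : ∀ t, MemLp (fun y => (H (y + δ t) - H y) / t) 2 volume := fun t =>
    (((hHm.comp_add_const (δ t)).sub hHm).const_mul t⁻¹).ae_eq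
      (Eventually.of_forall fun y => (div_eq_inv_mul _ _).symm)
  obtain ⟨C, hC0, hC⟩ := h.abs_score_mul_sqrt_add_sub_le
  -- Replacing `r t` by `√f` costs nothing: the quotient of `H` is bounded by a constant times `√f`,
  -- uniformly for small `t`, and `r t - √f` tends to zero in `L²`.
  have first : Tendsto (fun t => ∫ y, (r t y - √(f y)) * ((H (y + δ t) - H y) / t))
      (𝓝[≠] 0) (𝓝 0) := by
    have hb : Tendsto (fun t => ∫ y, ((C * (|d| + 1)) * |r t y - √(f y)|) * √(f y))
        (𝓝[≠] 0) (𝓝 0) := by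
      refine tendsto_integral_mul_zero (fun t => ?_) hs ?_
      · exact (((hr t).sub hs).norm.1.const_mul (C * (|d| + 1)))
      · have : ∀ t, eLpNorm (fun y => (C * (|d| + 1)) * |r t y - √(f y)|) 2 volume
            = ‖C * (|d| + 1)‖ₑ * eLpNorm (fun y => r t y - √(f y)) 2 volume := by
          intro t
          calc _ = eLpNorm ((C * (|d| + 1)) • fun y => ‖r t y - √(f y)‖) 2 volume := rfl
            _ = _ := by rw [eLpNorm_const_smul, eLpNorm_norm]
        simp_rw [this]
        simpa using ENNReal.Tendsto.const_mul (a := ‖C * (|d| + 1)‖ₑ) hlim (Or.inr enorm_ne_top)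
    refine squeeze_zero_norm' ?_ hb
    filter_upwards [hδ.eventually_abs_le h0, self_mem_nhdsWithin] with t ht ht0
    have ht' : 0 < |t| := abs_pos.2 ht0
    refine norm_integral_le_of_norm_le ?_ (Eventually.of_forall fun y => ?_)
    · exact (((hr t).sub hs).norm.const_mul (C * (|d| + 1))).integrable_mul hs
    · rw [norm_mul, Real.norm_eq_abs, Real.norm_eq_abs, abs_div]
      have h1 : |H (y + δ t) - H y| / |t| ≤ C * (|d| + 1) * √(f y) := by
        rw [div_le_iff₀ ht']
        calc _ ≤ C * |δ t| * √(f y) := hC y (δ t) ht.2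
          _ ≤ C * ((|d| + 1) * |t|) * √(f y) := by gcongr; exact ht.1
          _ = _ := by ring
      calc _ ≤ |r t y - √(f y)| * (C * (|d| + 1) * √(f y)) := by gcongr
        _ = _ := by ring
  -- A translation moves the shift from `H` to `√f`, where quadratic mean differentiability along
  -- `-δ` applies. No derivative of `S` is needed.
  have second : Tendsto (fun t => ∫ y, √(f y) * ((H (y + δ t) - H y) / t))
      (𝓝[≠] 0) (𝓝 (-d * fisherInfo f / 2)) := by
    have hδ' : HasDerivAt (fun t => -δ t) (-d) 0 := hδ.neg
    have hloc := h.tendsto_eLpNorm_location hδ' (by simp [h0])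
    have hX : ∀ t : ℝ, MemLp (fun y => (√(f (y + -δ t)) - √(f y)) / t) 2 volume := fun t =>
      (((hs.comp_add_const (-δ t)).sub hs).const_mul t⁻¹).ae_eq
        (Eventually.of_forall fun y => (div_eq_inv_mul _ _).symm)
    have hx : MemLp (fun y => -d * S y * √(f y) / 2) 2 volume :=
      (hHm.const_mul (-d / 2)).ae_eq (Eventually.of_forall fun y => by simp only [hH]; ring)
    have := tendsto_integral_mul hX hx hHm hloc
    have e : ∫ y, -d * S y * √(f y) / 2 * H y = -d * fisherInfo f / 2 := by
      rw [h.fisherInfo_eq, mul_div_assoc, mul_comm, ← integral_div, ← integral_mul_const]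
      refine integral_congr_ae (Eventually.of_forall fun y => ?_)
      simp only [hH]
      linear_combination (-d * S y ^ 2 / 2) * Real.sq_sqrt (h.pos y).le
    rw [e] at this
    refine this.congr fun t => ?_
    have i1 : Integrable fun y => √(f (y + -δ t)) * H y :=
      (hs.comp_add_const (-δ t)).integrable_mul hHm
    have i2 : Integrable fun y => √(f y) * H y := hs.integrable_mul hHm
    have i3 : Integrable fun y => √(f y) * H (y + δ t) :=
      hs.integrable_mul (hHm.comp_add_const (δ t))
    have e1 : ∫ y, √(f (y + -δ t)) * H y = ∫ y, √(f y) * H (y + δ t) := by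
      rw [← integral_add_right_eq_self _ (δ t)]
      simp only [add_neg_cancel_right]
    calc ∫ y, (√(f (y + -δ t)) - √(f y)) / t * H y
        = ∫ y, (√(f (y + -δ t)) * H y - √(f y) * H y) / t := by
          congr 1; funext y; ring
      _ = ∫ y, (√(f y) * H (y + δ t) - √(f y) * H y) / t := by
          rw [integral_div, integral_div, integral_sub i1 i2, integral_sub i3 i2, e1]
      _ = _ := by congr 1; funext y; ring
  have := first.add second
  rw [zero_add] at this
  refine this.congr fun t => ?_
  refine (integral_add (((hr t).sub hs).integrable_mul (hQ t))
    (hs.integrable_mul (hQ t))).symm.trans ?_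
  refine integral_congr_ae (Eventually.of_forall fun y => ?_)
  simp only [Pi.mul_apply, Pi.sub_apply]
  ring

/-- The effect derivative is a continuous linear functional of the score. -/
theorem integral_score_slices (h : HasLipschitzScore f S K) (hp0 : 0 < p) (hp1 : p < 1)
    {ft : ℝ → ℝ → ℝ} {τt : ℝ → ℝ} {τ' : ℝ} {g : Bool × ℝ → ℝ}
    (hM : IsRegularSubmodel p f τ ft τt τ' g) :
    (∫ y, S y * g (true, y + τ) * f y) - ∫ y, S y * g (false, y) * f y = -τ' * fisherInfo f := by
  have hq : 0 < 1 - p := by linarith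
  set H : ℝ → ℝ := fun y => S y * √(f y) with hH
  have hHm : MemLp H 2 volume := h.memLp_score_mul_sqrt
  have hs := h.memLp_sqrt
  have hrt : ∀ t, MemLp (fun y => √(ft t y)) 2 volume := fun t => (hM.regular t).memLp_sqrt
  obtain ⟨hg1, hg0⟩ := hM.score_memLp.slices hp0 hp1 h.continuous
  have hg1' : MemLp (fun y => g (true, y + τ) * √(f y) / 2) 2 volume :=
    ((memLp_two_mul_sqrt h.continuous h.pos hg1).const_mul 2⁻¹).ae_eq
      (Eventually.of_forall fun y => (div_eq_inv_mul _ _).symm)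
  have hg0' : MemLp (fun y => g (false, y) * √(f y) / 2) 2 volume :=
    ((memLp_two_mul_sqrt h.continuous h.pos hg0).const_mul 2⁻¹).ae_eq
      (Eventually.of_forall fun y => (div_eq_inv_mul _ _).symm)
  have hslice := fun z => tendsto_of_tendsto_of_tendsto_of_le_of_le tendsto_const_nhds
    hM.quadratic_mean (fun _ => zero_le) (fun t => eLpNorm_slice_le _ z)
  -- the quotients of the control arm
  have hX0 : ∀ t : ℝ, MemLp (fun y => (√(ft t y) - √(f y)) / t) 2 volume := fun t =>
    (((hrt t).sub hs).const_mul t⁻¹).ae_eq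
      (Eventually.of_forall fun y => (div_eq_inv_mul _ _).symm)
  have hX1 : ∀ t : ℝ, MemLp (fun y => (√(ft t (y + τ - τt t)) - √(f y)) / t) 2 volume := fun t =>
    (((((hrt t).comp_add_const (τ - τt t)).sub hs).const_mul t⁻¹)).ae_eq
      (Eventually.of_forall fun y => by
        simp only [Pi.sub_apply, ← add_sub_assoc]; exact (div_eq_inv_mul _ _).symm)
  -- The control slice of the quadratic mean expansion, divided by `√(1 - p)`.
  have lim0 : Tendsto (fun t : ℝ => eLpNorm (fun y =>
      (√(ft t y) - √(f y)) / t - g (false, y) * √(f y) / 2) 2 volume) (𝓝[≠] 0) (𝓝 0) := by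
    have h2 := ENNReal.Tendsto.const_mul (a := ‖(√(1 - p))⁻¹‖ₑ) (hslice false)
      (Or.inr enorm_ne_top)
    rw [mul_zero] at h2
    refine h2.congr fun t => ?_
    rw [← eLpNorm_const_smul]
    congr 1
    funext y
    simp only [additiveDensity, Bool.false_eq_true, if_false, Real.sqrt_mul hq.le, Pi.smul_apply,
      smul_eq_mul]
    have : √(1 - p) ≠ 0 := (Real.sqrt_pos.2 hq).ne'
    field_simp
  -- The treated slice, divided by `√p` and translated by `τ` to align it with the control arm.
  have lim1 : Tendsto (fun t : ℝ => eLpNorm (fun y =>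
      (√(ft t (y + τ - τt t)) - √(f y)) / t - g (true, y + τ) * √(f y) / 2) 2 volume)
      (𝓝[≠] 0) (𝓝 0) := by
    have h2 := ENNReal.Tendsto.const_mul (a := ‖(√p)⁻¹‖ₑ) (hslice true) (Or.inr enorm_ne_top)
    rw [mul_zero] at h2
    refine h2.congr fun t => ?_
    rw [← eLpNorm_const_smul, ← (measurePreserving_add_right volume τ).map_eq,
      (measurableEmbedding_addRight τ).eLpNorm_map_measure, map_add_right_eq_self]
    congr 1
    funext y
    simp only [additiveDensity, if_true, Real.sqrt_mul hp0.le, Pi.smul_apply, smul_eq_mul,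
      Function.comp, add_sub_cancel_right]
    have : √p ≠ 0 := (Real.sqrt_pos.2 hp0).ne'
    field_simp
  have A := tendsto_integral_mul hX1 hg1' hHm lim1
  have B := tendsto_integral_mul hX0 hg0' hHm lim0
  -- The difference is `t` times a quotient that converges in `L²`, hence stays bounded.
  have hconv : Tendsto (fun t => eLpNorm (fun y => √(ft t y) - √(f y)) 2 volume)
      (𝓝[≠] 0) (𝓝 0) := by
    have ht : Tendsto (fun t : ℝ => ‖t‖ₑ) (𝓝[≠] 0) (𝓝 0) := by
      have := (continuous_enorm (E := ℝ)).tendsto 0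
      rw [enorm_zero] at this
      exact this.mono_left nhdsWithin_le_nhds
    have hb : Tendsto (fun t : ℝ => ‖t‖ₑ * (eLpNorm (fun y =>
        (√(ft t y) - √(f y)) / t - g (false, y) * √(f y) / 2) 2 volume
          + eLpNorm (fun y => g (false, y) * √(f y) / 2) 2 volume)) (𝓝[≠] 0) (𝓝 0) := by
      have h1 := lim0.add (tendsto_const_nhds
        (x := eLpNorm (fun y => g (false, y) * √(f y) / 2) 2 volume))
      have := ENNReal.Tendsto.mul ht (Or.inr (by simpa using hg0'.2.ne)) h1
        (Or.inr ENNReal.zero_ne_top)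
      simpa using this
    refine tendsto_of_tendsto_of_tendsto_of_le_of_le' tendsto_const_nhds hb
      (Eventually.of_forall fun _ => zero_le) ?_
    filter_upwards [self_mem_nhdsWithin] with t ht0
    have e : (fun y => √(ft t y) - √(f y)) = t • fun y => (√(ft t y) - √(f y)) / t := by
      funext y
      simp only [Pi.smul_apply, smul_eq_mul]
      rw [mul_div_cancel₀ _ ht0]
    rw [e, eLpNorm_const_smul]
    gcongr
    have e2 : (fun y => (√(ft t y) - √(f y)) / t)
        = (fun y => (√(ft t y) - √(f y)) / t - g (false, y) * √(f y) / 2)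
          + fun y => g (false, y) * √(f y) / 2 := by
      funext y; simp
    conv_lhs => rw [e2]
    exact eLpNorm_add_le ((hX0 t).sub hg0').1 hg0'.1 one_le_two
  have hδ : HasDerivAt (fun t => τt t - τ) τ' 0 := hM.effect_deriv.sub_const τ
  have D := h.tendsto_integral_mul_shift hδ (by simp [hM.effect_zero]) hrt hconv
  -- The cancellation of the nuisance: translating the treated integral moves `τt t - τ` onto `H`,
  -- the terms `√(f)` divided by `t` cancel, and both arms are left with the same factor `√(ft t)`.
  have hAB : ∀ t : ℝ, (∫ y, (√(ft t (y + τ - τt t)) - √(f y)) / t * H y)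
      - (∫ y, (√(ft t y) - √(f y)) / t * H y)
      = ∫ y, √(ft t y) * ((S (y + (τt t - τ)) * √(f (y + (τt t - τ))) - S y * √(f y)) / t) := by
    intro t
    have i1 : Integrable fun y => √(ft t (y + τ - τt t)) * H y := by
      simp only [add_sub_assoc]
      exact ((hrt t).comp_add_const (τ - τt t)).integrable_mul hHm
    have i2 : Integrable fun y => √(ft t y) * H y := (hrt t).integrable_mul hHm
    have i3 : Integrable fun y => √(ft t y) * H (y + (τt t - τ)) :=
      (hrt t).integrable_mul (hHm.comp_add_const (τt t - τ))
    have e1 : ∫ y, √(ft t (y + τ - τt t)) * H y = ∫ y, √(ft t y) * H (y + (τt t - τ)) := by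
      rw [← integral_add_right_eq_self _ (τt t - τ)]
      refine integral_congr_ae (Eventually.of_forall fun y => ?_)
      simp only
      rw [show y + (τt t - τ) + τ - τt t = y by ring]
    refine (integral_sub ((hX1 t).integrable_mul hHm) ((hX0 t).integrable_mul hHm)).symm.trans ?_
    calc _ = ∫ y, (√(ft t (y + τ - τt t)) * H y - √(ft t y) * H y) / t := by
          congr 1; funext y; simp only [Pi.mul_apply]; ring
      _ = ∫ y, (√(ft t y) * H (y + (τt t - τ)) - √(ft t y) * H y) / t := by
          rw [integral_div, integral_div, integral_sub i1 i2, integral_sub i3 i2, e1]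
      _ = _ := by congr 1; funext y; simp only [hH]; ring
  have hlim := tendsto_nhds_unique ((A.sub B).congr hAB) D
  have eA : ∀ u : ℝ → ℝ, ∫ y, u y * √(f y) / 2 * H y = (∫ y, S y * u y * f y) / 2 := by
    intro u
    rw [← integral_div]
    refine integral_congr_ae (Eventually.of_forall fun y => ?_)
    simp only [hH]
    linear_combination (u y * S y / 2) * Real.sq_sqrt (h.pos y).le
  rw [eA (fun y => g (true, y + τ)), eA (fun y => g (false, y))] at hlim
  linarith

/-- The gradient property is the identity for the slices divided by `-I`; the arm weights `p` and `1
- p` cancel against the denominators of `ψ`. For the tangent space the approximation is exact, `ψ`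
being itself a score. -/
theorem isEfficientInfluenceFunction (h : HasLipschitzScore f S K) (hp0 : 0 < p) (hp1 : p < 1)
    (hI : 0 < fisherInfo f) :
    IsEfficientInfluenceFunction p f τ (additiveInfluence p S (fisherInfo f) τ) where
  memLp := h.memLp_additiveInfluence hp0 hp1
  mean_zero := h.integral_additiveInfluence hp0 hp1
  gradient ft τt τ' g hM := by
    have hq : 0 < 1 - p := by linarith
    rw [integral_additiveLaw (φ := fun w => additiveInfluence p S (fisherInfo f) τ w * g w)
      hp0 hp1 h.continuous (fun x => (h.pos x).le) τ
      ((h.memLp_additiveInfluence hp0 hp1).integrable_mul hM.score_memLp)]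
    have key := h.integral_score_slices hp0 hp1 hM
    have e1 : ∫ y, additiveInfluence p S (fisherInfo f) τ (true, y + τ) * g (true, y + τ) * f y
        = -(∫ y, S y * g (true, y + τ) * f y) / (p * fisherInfo f) := by
      rw [← integral_neg, ← integral_div]
      refine integral_congr_ae (Eventually.of_forall fun y => ?_)
      simp only [additiveInfluence, if_true, add_sub_cancel_right]
      ring
    have e0 : ∫ y, additiveInfluence p S (fisherInfo f) τ (false, y) * g (false, y) * f y
        = (∫ y, S y * g (false, y) * f y) / ((1 - p) * fisherInfo f) := by
      rw [← integral_div]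
      refine integral_congr_ae (Eventually.of_forall fun y => ?_)
      simp only [additiveInfluence, Bool.false_eq_true, if_false]
      ring
    rw [e1, e0]
    field_simp
    linarith
  tangent ε _ := by
    refine ⟨_, Submodule.subset_span ⟨_, _, _, h.isRegularSubmodel_additiveInfluence hp0 hp1 hI⟩, ?_⟩
    simp

/-- The upper bound is Cauchy–Schwarz for `τ' = E[ψ g]`. The submodel with score `ψ` has `τ' =
E[ψ²]`, so the supremum is attained there. -/
theorem isInformationBound (h : HasLipschitzScore f S K) (hp0 : 0 < p) (hp1 : p < 1)
    (hI : 0 < fisherInfo f) :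
    IsInformationBound p f τ (1 / (p * (1 - p) * fisherInfo f)) := by
  have hq : 0 < 1 - p := by linarith
  have hψ := h.memLp_additiveInfluence (τ := τ) hp0 hp1
  have hsq := h.integral_additiveInfluence_sq (τ := τ) hp0 hp1 hI
  have hpos : 0 < 1 / (p * (1 - p) * fisherInfo f) := by positivity
  refine ⟨?_, fun b hb => hb ?_⟩
  · rintro v ⟨ft, τt, τ', g, hM, hg, rfl⟩
    have hgrad := (h.isEfficientInfluenceFunction hp0 hp1 hI).gradient ft τt τ' g hM
    set ψ := additiveInfluence p S (fisherInfo f) τ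
    set B := ∫ w, g w ^ 2 ∂(additiveLaw p f τ)
    have i1 := hψ.integrable_sq
    have i2 := hM.score_memLp.integrable_sq
    have i3 : Integrable (fun w => ψ w * g w) (additiveLaw p f τ) := hψ.integrable_mul hM.score_memLp
    -- The coefficient `τ' / B` is that of the `L²` projection of `ψ` on `g`, which makes the
    -- inequality sharp.
    have hnn : 0 ≤ ∫ w, (ψ w - τ' / B * g w) ^ 2 ∂(additiveLaw p f τ) :=
      integral_nonneg fun w => sq_nonneg _
    have e : ∫ w, (ψ w - τ' / B * g w) ^ 2 ∂(additiveLaw p f τ)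
        = (∫ w, ψ w ^ 2 ∂(additiveLaw p f τ)) - 2 * (τ' / B) * τ' + (τ' / B) ^ 2 * B := by
      have e' : ∀ c : ℝ, ∫ w, (ψ w - c * g w) ^ 2 ∂(additiveLaw p f τ)
          = (∫ w, ψ w ^ 2 ∂(additiveLaw p f τ)) - 2 * c * (∫ w, ψ w * g w ∂(additiveLaw p f τ))
            + c ^ 2 * B := by
        intro c
        rw [← integral_const_mul (2 * c), ← integral_const_mul (c ^ 2), ← integral_sub i1
          (i3.const_mul _)]
        refine Eq.trans ?_ (integral_add (i1.sub (i3.const_mul _)) (i2.const_mul _))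
        refine integral_congr_ae (Eventually.of_forall fun w => ?_)
        simp only
        ring
      rw [e' (τ' / B), ← hgrad]
    rw [e, hsq] at hnn
    have : 2 * (τ' / B) * τ' - (τ' / B) ^ 2 * B = τ' ^ 2 / B := by
      field_simp
      ring
    linarith
  · refine ⟨_, _, _, _, h.isRegularSubmodel_additiveInfluence hp0 hp1 hI, by rwa [hsq], ?_⟩
    rw [hsq, sq, mul_div_assoc, div_self hpos.ne', mul_one]

end HasLipschitzScore

/-! ### Quantile functions and trimmed means of a probability measure -/

/-- The distribution function of a measure on the line. -/
noncomputable def measureCDF (ν : Measure ℝ) (x : ℝ) : ℝ := ν.real (Set.Iic x)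

section Quantile

variable {ν : Measure ℝ} [IsProbabilityMeasure ν] {u : ℝ}

/-- Right continuity puts the infimum inside the set. The levels `0` and `1` are excluded because
there the set may be unbounded below or empty. -/
theorem quantile_le_iff (hu0 : 0 < u) (hu1 : u < 1) (x : ℝ) :
    quantile (measureCDF ν) u ≤ x ↔ u ≤ measureCDF ν x := by
  have hF : measureCDF ν = cdf ν := by funext x; rw [cdf_eq_real]; rfl
  rw [hF]
  set A := {x | u ≤ cdf ν x} with hA
  have hne : A.Nonempty :=
    ((tendsto_cdf_atTop ν).eventually (Ioi_mem_nhds hu1)).exists.imp fun x hx => le_of_lt hx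
  have hbdd : BddBelow A := by
    obtain ⟨y, hy⟩ := ((tendsto_cdf_atBot ν).eventually (Iio_mem_nhds hu0)).exists
    refine ⟨y, fun x hx => ?_⟩
    by_contra h
    exact absurd (hx.trans (monotone_cdf ν (not_le.1 h).le)) (not_le.2 hy)
  have hmem : u ≤ cdf ν (sInf A) := by
    have hrc : Tendsto (cdf ν) (𝓝[>] sInf A) (𝓝 (cdf ν (sInf A))) :=
      ((cdf ν).right_continuous (sInf A)).tendsto.mono_left (nhdsWithin_mono _ Set.Ioi_subset_Ici_self)
    refine ge_of_tendsto hrc ?_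
    filter_upwards [self_mem_nhdsWithin] with y hy
    obtain ⟨x, hx, hxy⟩ := exists_lt_of_csInf_lt hne hy
    exact le_trans hx (monotone_cdf ν hxy.le)
  constructor
  · intro h
    exact hmem.trans (monotone_cdf ν h)
  · intro h
    exact csInf_le hbdd h

theorem quantile_monotoneOn : MonotoneOn (quantile (measureCDF ν)) (Set.Ioo 0 1) := by
  intro u hu v hv huv
  rw [quantile_le_iff hu.1 hu.2]
  exact huv.trans ((quantile_le_iff hv.1 hv.2 _).1 le_rfl)

/-- Inverse transform sampling: by `quantile_le_iff` the preimage of `(-∞, x]` consists of the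
levels at most `F x`. -/
theorem map_quantile :
    (volume.restrict (Set.Ioo (0 : ℝ) 1)).map (quantile (measureCDF ν)) = ν := by
  have hm : AEMeasurable (quantile (measureCDF ν)) (volume.restrict (Set.Ioo (0 : ℝ) 1)) :=
    aemeasurable_restrict_of_monotoneOn measurableSet_Ioo quantile_monotoneOn
  have hprob : IsProbabilityMeasure (volume.restrict (Set.Ioo (0 : ℝ) 1)) := ⟨by simp⟩
  have := Measure.isProbabilityMeasure_map hm
  refine Measure.ext_of_Iic _ _ fun x => ?_
  rw [Measure.map_apply_of_aemeasurable hm measurableSet_Iic]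
  have h1 : measureCDF ν x ≤ 1 := measureReal_le_one
  have h2 : (volume.restrict (Set.Ioo (0 : ℝ) 1)) (quantile (measureCDF ν) ⁻¹' Set.Iic x)
      = (volume.restrict (Set.Ioo (0 : ℝ) 1)) (Set.Iic (measureCDF ν x)) := by
    refine measure_congr ?_
    filter_upwards [ae_restrict_mem measurableSet_Ioo] with u hu
    exact propext (quantile_le_iff hu.1 hu.2 x)
  rw [h2, Measure.restrict_congr_set Ioo_ae_eq_Ioc, Measure.restrict_apply measurableSet_Iic,
    Set.inter_comm, Set.Ioc_inter_Iic, min_eq_right h1, Real.volume_Ioc, sub_zero]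
  exact ofReal_measureReal

theorem integral_comp_quantile {φ : ℝ → ℝ} (hφ : Continuous φ) :
    ∫ u in (0 : ℝ)..1, φ (quantile (measureCDF ν) u) = ∫ y, φ y ∂ν := by
  have hm : AEMeasurable (quantile (measureCDF ν)) (volume.restrict (Set.Ioo (0 : ℝ) 1)) :=
    aemeasurable_restrict_of_monotoneOn measurableSet_Ioo quantile_monotoneOn
  conv_rhs => rw [← map_quantile (ν := ν)]
  rw [integral_map hm hφ.aestronglyMeasurable, intervalIntegral.integral_of_le zero_le_one,
    integral_Ioc_eq_integral_Ioo]

theorem intervalIntegrable_quantile {α γ : ℝ} (hα : 0 < α) (hαγ : α ≤ γ) (hγ : γ < 1) :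
    IntervalIntegrable (quantile (measureCDF ν)) volume α γ :=
  MonotoneOn.intervalIntegrable (quantile_monotoneOn.mono (by
    rw [Set.uIcc_of_le hαγ]
    exact fun u hu => ⟨hα.trans_le hu.1, hu.2.trans_lt hγ⟩))

/-- The integrated quantile function between `α` and `γ` is, up to a product of two small terms at
each of the two ends, the mean of the observations clipped to `[a, b]`. -/
theorem abs_integral_quantile_sub_le {α γ a b : ℝ} (hα : 0 < α) (hαγ : α < γ) (hγ : γ < 1)
    (hab : a ≤ b) :
    |(∫ u in α..γ, quantile (measureCDF ν) u)
        - ((∫ y, max a (min b y) ∂ν) - α * a - (1 - γ) * b)|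
      ≤ |quantile (measureCDF ν) α - a| * |measureCDF ν a - α|
        + |quantile (measureCDF ν) γ - b| * |measureCDF ν b - γ| := by
  set q := quantile (measureCDF ν) with hq
  set c : ℝ → ℝ := fun y => max a (min b y) with hc
  have hcc : Continuous c := continuous_const.max (continuous_const.min continuous_id)
  -- `w` replaces the quantiles by `a` and `b` according to the level `u`, while `c ∘ q` does so
  -- according to the value `q u`. The two rules disagree only for `u` between `α` and `F a` or
  -- between `γ` and `F b`.
  set w : ℝ → ℝ := fun u => if u ≤ α then a else if u ≤ γ then q u else b with hw
  have gal : ∀ {u}, u ∈ Set.Ioo (0 : ℝ) 1 → ∀ x, q u ≤ x ↔ u ≤ measureCDF ν x :=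
    fun hu x => quantile_le_iff hu.1 hu.2 x
  have hαI : α ∈ Set.Ioo (0 : ℝ) 1 := ⟨hα, hαγ.trans hγ⟩
  have hγI : γ ∈ Set.Ioo (0 : ℝ) 1 := ⟨hα.trans hαγ, hγ⟩
  have w1 : Set.EqOn w (fun _ => a) (Set.Ioc 0 α) := fun u hu => if_pos hu.2
  have w2 : Set.EqOn w q (Set.Ioc α γ) := fun u hu => by
    simp only [hw, if_neg (not_le.2 hu.1), if_pos hu.2]
  have w3 : Set.EqOn w (fun _ => b) (Set.Ioc γ 1) := fun u hu => by
    simp only [hw, if_neg (not_le.2 (hαγ.trans hu.1)), if_neg (not_le.2 hu.1)]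
  have hqi : IntervalIntegrable q volume α γ := intervalIntegrable_quantile hα hαγ.le hγ
  have i1 : IntervalIntegrable w volume 0 α :=
    (intervalIntegrable_const (c := a)).congr (by rw [Set.uIoc_of_le hα.le]; exact w1.symm)
  have i2 : IntervalIntegrable w volume α γ :=
    hqi.congr (by rw [Set.uIoc_of_le hαγ.le]; exact w2.symm)
  have i3 : IntervalIntegrable w volume γ 1 :=
    (intervalIntegrable_const (c := b)).congr (by rw [Set.uIoc_of_le hγ.le]; exact w3.symm)
  have hwint : ∫ u in (0 : ℝ)..1, w u = α * a + (∫ u in α..γ, q u) + (1 - γ) * b := by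
    rw [← intervalIntegral.integral_add_adjacent_intervals (i1.trans i2) i3,
      ← intervalIntegral.integral_add_adjacent_intervals i1 i2,
      intervalIntegral.integral_of_le hα.le, intervalIntegral.integral_of_le hαγ.le,
      intervalIntegral.integral_of_le hγ.le, setIntegral_congr_fun measurableSet_Ioc w1,
      setIntegral_congr_fun measurableSet_Ioc w2, setIntegral_congr_fun measurableSet_Ioc w3,
      setIntegral_const, setIntegral_const, ← intervalIntegral.integral_of_le hαγ.le]
    simp [measureReal_def, hα.le, hγ.le]
  have hcint : IntervalIntegrable (fun u => c (q u)) volume 0 1 := by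
    rw [intervalIntegrable_iff_integrableOn_Ioo_of_le zero_le_one]
    have hm : AEMeasurable q (volume.restrict (Set.Ioo (0 : ℝ) 1)) :=
      aemeasurable_restrict_of_monotoneOn measurableSet_Ioo quantile_monotoneOn
    refine Integrable.of_bound (C := max |a| |b|)
      (hcc.measurable.comp_aemeasurable hm).aestronglyMeasurable (Eventually.of_forall fun u => ?_)
    rw [Real.norm_eq_abs]
    refine abs_le_max_abs_abs (le_max_left _ _) (max_le hab (min_le_left _ _))
  have hmain : (∫ u in α..γ, q u) - ((∫ y, c y ∂ν) - α * a - (1 - γ) * b)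
      = ∫ u in (0 : ℝ)..1, (w u - c (q u)) := by
    rw [intervalIntegral.integral_sub ((i1.trans i2).trans i3) hcint, hwint,
      integral_comp_quantile hcc]
    ring
  set s := Set.uIoc α (measureCDF ν a) with hs
  set t := Set.uIoc γ (measureCDF ν b) with ht
  set A := |q α - a| with hA
  set B := |q γ - b| with hB
  -- Where the rules disagree, monotonicity of `q` puts `q u` between `a` and `q α`, or between `b`
  -- and `q γ`. Integrating the indicators then yields the two products.
  have hbound : ∀ u ∈ Set.Ioo (0 : ℝ) 1,
      |w u - c (q u)| ≤ s.indicator (fun _ => A) u + t.indicator (fun _ => B) u := by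
    intro u hu
    have hs0 : 0 ≤ s.indicator (fun _ => A) u := Set.indicator_nonneg (fun _ _ => abs_nonneg _) u
    have ht0 : 0 ≤ t.indicator (fun _ => B) u := Set.indicator_nonneg (fun _ _ => abs_nonneg _) u
    rcases le_or_gt u α with h1 | h1
    · have hwu : w u = a := if_pos h1
      rw [hwu]
      rcases le_or_gt (q u) a with h2 | h2
      · have : c (q u) = a := max_eq_left ((min_le_right _ _).trans h2)
        rw [this, sub_self, abs_zero]
        exact add_nonneg hs0 ht0
      · have hus : u ∈ s := Set.mem_uIoc.2 (Or.inr ⟨not_le.1 fun h => h2.not_ge ((gal hu a).2 h), h1⟩)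
        rw [Set.indicator_of_mem hus]
        have hmono : q u ≤ q α := quantile_monotoneOn hu hαI h1
        have c1 : a ≤ c (q u) := le_max_left _ _
        have c2 : c (q u) ≤ q u := max_le h2.le (min_le_right _ _)
        have := le_abs_self (q α - a)
        rw [abs_sub_comm, abs_of_nonneg (by linarith)]
        linarith
    · rcases le_or_gt u γ with h3 | h3
      · have hwu : w u = q u := w2 ⟨h1, h3⟩
        rw [hwu]
        rcases lt_or_ge (q u) a with h2 | h2
        · have hus : u ∈ s := Set.mem_uIoc.2 (Or.inl ⟨h1, (gal hu a).1 h2.le⟩)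
          rw [Set.indicator_of_mem hus]
          have hmono : q α ≤ q u := quantile_monotoneOn hαI hu h1.le
          have : c (q u) = a := max_eq_left ((min_le_right _ _).trans h2.le)
          have := neg_abs_le (q α - a)
          rw [abs_of_nonpos (by linarith)]
          linarith
        · rcases le_or_gt (q u) b with h4 | h4
          · have : c (q u) = q u := by simp only [hc, min_eq_right h4, max_eq_right h2]
            rw [this, sub_self, abs_zero]
            exact add_nonneg hs0 ht0
          · have hut : u ∈ t :=
              Set.mem_uIoc.2 (Or.inr ⟨not_le.1 fun h => h4.not_ge ((gal hu b).2 h), h3⟩)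
            rw [Set.indicator_of_mem hut]
            have hmono : q u ≤ q γ := quantile_monotoneOn hu hγI h3
            have : c (q u) = b := by simp only [hc, min_eq_left h4.le, max_eq_right hab]
            have := le_abs_self (q γ - b)
            rw [abs_of_nonneg (by linarith)]
            linarith
      · have hwu : w u = b := w3 ⟨h3, hu.2.le⟩
        rw [hwu]
        rcases le_or_gt (q u) b with h4 | h4
        · have hut : u ∈ t := Set.mem_uIoc.2 (Or.inl ⟨h3, (gal hu b).1 h4⟩)
          rw [Set.indicator_of_mem hut]
          have hmono : q γ ≤ q u := quantile_monotoneOn hγI hu h3.le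
          have c1 : c (q u) ≤ b := max_le hab (min_le_left _ _)
          have c2 : q u ≤ c (q u) := by
            simp only [hc, min_eq_right h4]; exact le_max_right _ _
          have := neg_abs_le (q γ - b)
          rw [abs_of_nonneg (by linarith)]
          linarith
        · have : c (q u) = b := by simp only [hc, min_eq_left h4.le, max_eq_right hab]
          rw [this, sub_self, abs_zero]
          exact add_nonneg hs0 ht0
  have hsi : Integrable (s.indicator fun _ => A) :=
    (integrable_indicator_iff measurableSet_uIoc).2 (integrableOn_const (by simp [Set.uIoc]))
  have hti : Integrable (t.indicator fun _ => B) :=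
    (integrable_indicator_iff measurableSet_uIoc).2 (integrableOn_const (by simp [Set.uIoc]))
  have hst : Integrable fun u => s.indicator (fun _ => A) u + t.indicator (fun _ => B) u :=
    hsi.add hti
  have hvol : ∀ x y : ℝ, volume.real (Set.uIoc x y) = |y - x| := fun x y => by
    rw [measureReal_def, Set.uIoc, Real.volume_Ioc, ENNReal.toReal_ofReal
      (sub_nonneg.2 min_le_max), max_sub_min_eq_abs]
  rw [hmain, intervalIntegral.integral_of_le zero_le_one, integral_Ioc_eq_integral_Ioo]
  calc |∫ u in Set.Ioo (0 : ℝ) 1, (w u - c (q u))|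
      ≤ ∫ u in Set.Ioo (0 : ℝ) 1, (s.indicator (fun _ => A) u + t.indicator (fun _ => B) u) :=
by
        rw [← Real.norm_eq_abs]
        exact norm_integral_le_of_norm_le hst.integrableOn
          ((ae_restrict_mem measurableSet_Ioo).mono hbound)
    _ ≤ ∫ u, (s.indicator (fun _ => A) u + t.indicator (fun _ => B) u) :=
        setIntegral_le_integral hst (Eventually.of_forall fun u =>
          add_nonneg (Set.indicator_nonneg (fun _ _ => abs_nonneg _) u)
            (Set.indicator_nonneg (fun _ _ => abs_nonneg _) u))
    _ = _ := by
        rw [integral_add hsi hti, integral_indicator measurableSet_uIoc,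
          integral_indicator measurableSet_uIoc, setIntegral_const, setIntegral_const, hvol, hvol,
          smul_eq_mul, smul_eq_mul, mul_comm, mul_comm B]

end Quantile

/-! ### The empirical measures of the arms -/

/-- The number of the first `n` observations in the arm `z`. -/
def armSize (z : Bool) (n : ℕ) (d : ℕ → Bool × ℝ) : ℕ :=
  ((Finset.range n).filter fun i => (d i).1 = z).card

/-- The sum of `φ (Yᵢ)` over the observations of the arm `z`. -/
noncomputable def armSum (z : Bool) (φ : ℝ → ℝ) (n : ℕ) (d : ℕ → Bool × ℝ) : ℝ :=
  ∑ i ∈ Finset.range n, if (d i).1 = z then φ (d i).2 else 0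

/-- The empirical measure of the outcomes in the arm `z`. -/
noncomputable def armMeasure (z : Bool) (n : ℕ) (d : ℕ → Bool × ℝ) : Measure ℝ :=
  (armSize z n d : ENNReal)⁻¹ •
    ∑ i ∈ (Finset.range n).filter fun i => (d i).1 = z, Measure.dirac (d i).2

section Arm

variable {z : Bool} {n : ℕ} {d : ℕ → Bool × ℝ}

theorem armSize_eq_armSum : (armSize z n d : ℝ) = armSum z (fun _ => 1) n d := by
  rw [armSize, Finset.card_filter]
  push_cast
  rfl

theorem isProbabilityMeasure_armMeasure (h : armSize z n d ≠ 0) :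
    IsProbabilityMeasure (armMeasure z n d) := by
  constructor
  simp only [armMeasure, Measure.coe_smul, Pi.smul_apply, smul_eq_mul, Measure.coe_finsetSum,
    Finset.sum_apply, measure_univ, Finset.sum_const, nsmul_eq_mul, mul_one]
  exact ENNReal.inv_mul_cancel (by exact_mod_cast h) (ENNReal.natCast_ne_top _)

theorem integral_armMeasure (φ : ℝ → ℝ) :
    ∫ y, φ y ∂(armMeasure z n d) = armSum z φ n d / armSize z n d := by
  rw [armMeasure, integral_smul_measure, integral_finsetSum_measure
    (fun i _ => integrable_dirac (by simp))]
  simp only [integral_dirac, ENNReal.toReal_inv, ENNReal.toReal_natCast, smul_eq_mul, armSum,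
    ← Finset.sum_filter]
  rw [inv_mul_eq_div]

theorem empiricalCDF_eq_div (x : ℝ) :
    empiricalCDF z n d x = armSum z (Set.indicator (Set.Iic x) 1) n d / armSize z n d := by
  unfold empiricalCDF armSum armSize
  congr 1
  rw [Finset.card_filter]
  push_cast
  refine Finset.sum_congr rfl fun i _ => ?_
  by_cases h1 : (d i).1 = z <;> by_cases h2 : (d i).2 ≤ x <;> simp [h1, h2]

theorem measureCDF_armMeasure : measureCDF (armMeasure z n d) = empiricalCDF z n d := by
  funext x
  rw [empiricalCDF_eq_div, ← integral_armMeasure, integral_indicator_one measurableSet_Iic]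
  rfl

/-- In an empty arm division by zero makes the empirical distribution function `0`, so no point
reaches a positive level and `sInf ∅ = 0`. -/
theorem quantile_empiricalCDF_of_armSize_eq_zero (h : armSize z n d = 0) {u : ℝ} (hu : 0 < u) :
    quantile (empiricalCDF z n d) u = 0 := by
  have : {x | u ≤ empiricalCDF z n d x} = ∅ := by
    refine Set.eq_empty_of_forall_notMem fun x hx => ?_
    rw [Set.mem_ofPred_eq, empiricalCDF_eq_div, h, Nat.cast_zero, div_zero] at hx
    exact absurd hx (not_le.2 hu)
  rw [quantile, this, Real.sInf_empty]

theorem quantile_empiricalCDF_le_iff (h : armSize z n d ≠ 0) {u : ℝ} (hu0 : 0 < u) (hu1 : u < 1)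
    (x : ℝ) : quantile (empiricalCDF z n d) u ≤ x ↔ u ≤ empiricalCDF z n d x := by
  have := isProbabilityMeasure_armMeasure h
  rw [← measureCDF_armMeasure]
  exact quantile_le_iff hu0 hu1 x

theorem intervalIntegrable_quantile_empiricalCDF {α γ : ℝ} (hα : 0 < α) (hαγ : α ≤ γ) (hγ : γ < 1) :
    IntervalIntegrable (quantile (empiricalCDF z n d)) volume α γ := by
  by_cases h : armSize z n d = 0
  · refine (intervalIntegrable_const (c := (0 : ℝ))).congr ?_
    rw [Set.uIoc_of_le hαγ]
    exact fun u hu => (quantile_empiricalCDF_of_armSize_eq_zero h (hα.trans hu.1)).symm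
  · have := isProbabilityMeasure_armMeasure h
    rw [← measureCDF_armMeasure]
    exact intervalIntegrable_quantile hα hαγ hγ

/-- The remainder of the linearization of the integrated empirical quantile function. -/
noncomputable def trimRemainder (z : Bool) (α γ a b : ℝ) (n : ℕ) (d : ℕ → Bool × ℝ) : ℝ :=
  |quantile (empiricalCDF z n d) α - a| * |empiricalCDF z n d a - α|
    + |quantile (empiricalCDF z n d) γ - b| * |empiricalCDF z n d b - γ|

theorem abs_integral_quantile_empiricalCDF_sub_le {α γ a b : ℝ} (h : armSize z n d ≠ 0) (hα : 0 < α)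
    (hαγ : α < γ) (hγ : γ < 1) (hab : a ≤ b) :
    |(∫ u in α..γ, quantile (empiricalCDF z n d) u)
        - (armSum z (fun y => max a (min b y)) n d / armSize z n d - α * a - (1 - γ) * b)|
      ≤ trimRemainder z α γ a b n d := by
  have := isProbabilityMeasure_armMeasure h
  rw [trimRemainder, ← measureCDF_armMeasure, ← integral_armMeasure]
  exact abs_integral_quantile_sub_le hα hαγ hγ hab

end Arm

/-! ### Measurability of the trimmed mean difference -/

section Measurability

variable {Ω : Type*} [MeasurableSpace Ω] {D : ℕ → Ω → Bool × ℝ}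

theorem measurable_armSum (hD : ∀ i, Measurable (D i)) (z : Bool) {φ : ℝ → ℝ} (hφ : Measurable φ)
    (n : ℕ) : Measurable fun ω => armSum z φ n (fun i => D i ω) := by
  refine Finset.measurable_sum _ fun i _ => ?_
  exact Measurable.ite ((measurable_fst.comp (hD i)) (measurableSet_singleton z))
    (hφ.comp (measurable_snd.comp (hD i))) measurable_const

theorem measurable_empiricalCDF (hD : ∀ i, Measurable (D i)) (z : Bool) (n : ℕ) (x : ℝ) :
    Measurable fun ω => empiricalCDF z n (fun i => D i ω) x := by
  simp only [empiricalCDF_eq_div, armSize_eq_armSum]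
  exact (measurable_armSum hD z (measurable_one.indicator measurableSet_Iic) n).div
    (measurable_armSum hD z measurable_const n)

theorem measurableSet_armSize_eq_zero (hD : ∀ i, Measurable (D i)) (z : Bool) (n : ℕ) :
    MeasurableSet {ω | armSize z n (fun i => D i ω) = 0} := by
  have : {ω | armSize z n (fun i => D i ω) = 0}
      = {ω | armSum z (fun _ => 1) n (fun i => D i ω) = 0} := by
    ext ω
    simp only [Set.mem_ofPred_eq, ← armSize_eq_armSum, Nat.cast_eq_zero]
  rw [this]
  exact measurableSet_eq_fun (measurable_armSum hD z measurable_const n) measurable_const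

/-- Joint measurability in the sample and the level makes the integral over levels a random
variable. The value is set to `0` outside `(0, 1)`, where the equivalence describing the sublevel
sets is not available. -/
theorem measurable_quantile_empiricalCDF (hD : ∀ i, Measurable (D i)) (z : Bool) (n : ℕ) :
    Measurable fun x : Ω × ℝ => if 0 < x.2 ∧ x.2 < 1 then
      quantile (empiricalCDF z n (fun i => D i x.1)) x.2 else 0 := by
  refine measurable_of_Iic fun y => ?_
  have h0 : MeasurableSet {x : Ω × ℝ | 0 < x.2 ∧ x.2 < 1} :=
    (measurableSet_lt measurable_const measurable_snd).inter
      (measurableSet_lt measurable_snd measurable_const)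
  have h1 : MeasurableSet {x : Ω × ℝ | armSize z n (fun i => D i x.1) = 0} :=
    measurable_fst (measurableSet_armSize_eq_zero hD z n)
  have h2 : MeasurableSet {x : Ω × ℝ | x.2 ≤ empiricalCDF z n (fun i => D i x.1) y} :=
    measurableSet_le measurable_snd ((measurable_empiricalCDF hD z n y).comp measurable_fst)
  have h3 : MeasurableSet {_x : Ω × ℝ | 0 ≤ y} := MeasurableSet.const _
  convert (h0.inter ((h1.inter h3).union (h1.compl.inter h2))).union (h0.compl.inter h3) using 1
  ext ⟨ω, u⟩
  by_cases hu : 0 < u ∧ u < 1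
  · by_cases hz : armSize z n (fun i => D i ω) = 0
    · simp [hu, hz, quantile_empiricalCDF_of_armSize_eq_zero hz hu.1]
    · simp [hu, hz, quantile_empiricalCDF_le_iff hz hu.1 hu.2]
  · simp only [Set.mem_preimage, Set.mem_Iic, Set.mem_union, Set.mem_inter_iff,
      Set.mem_ofPred_eq, hu, false_and, Set.mem_compl_iff, not_false_eq_true, true_and, false_or,
      if_false]

theorem measurable_quantile_empiricalCDF_const (hD : ∀ i, Measurable (D i)) (z : Bool) (n : ℕ) {u : ℝ}
    (hu0 : 0 < u) (hu1 : u < 1) :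
    Measurable fun ω => quantile (empiricalCDF z n (fun i => D i ω)) u := by
  have := (measurable_quantile_empiricalCDF hD z n).comp (measurable_prodMk_right (y := u))
  simpa [Function.comp_def, hu0, hu1] using this

theorem measurable_integral_quantile (hD : ∀ i, Measurable (D i)) (z : Bool) (n : ℕ) {α γ : ℝ}
    (hα : 0 < α) (hαγ : α ≤ γ) (hγ : γ < 1) :
    Measurable fun ω => ∫ u in α..γ, quantile (empiricalCDF z n (fun i => D i ω)) u := by
  have h := ((measurable_quantile_empiricalCDF hD z n).stronglyMeasurable.integral_prod_right'
    (ν := volume.restrict (Set.Ioc α γ))).measurable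
  convert h using 2 with ω
  rw [intervalIntegral.integral_of_le hαγ]
  refine setIntegral_congr_fun measurableSet_Ioc fun u hu => ?_
  have hu' : 0 < u ∧ u < 1 := ⟨hα.trans hu.1, hu.2.trans_lt hγ⟩
  simp only [hu', and_self, if_true]

theorem trimmedMeanDiff_eq {α β : ℝ} (hα : 0 < α) (hβ : 0 < β) (hαβ : α + β < 1) (n : ℕ)
    (d : ℕ → Bool × ℝ) : trimmedMeanDiff α β n d = 1 / (1 - (α + β)) *
      ((∫ u in α..(1 - β), quantile (empiricalCDF true n d) u)
        - ∫ u in α..(1 - β), quantile (empiricalCDF false n d) u) := by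
  rw [trimmedMeanDiff, intervalIntegral.integral_sub
    (intervalIntegrable_quantile_empiricalCDF hα (by linarith) (by linarith))
    (intervalIntegrable_quantile_empiricalCDF hα (by linarith) (by linarith))]

theorem measurable_trimmedMeanDiff (hD : ∀ i, Measurable (D i)) {α β : ℝ} (hα : 0 < α) (hβ : 0 < β)
    (hαβ : α + β < 1) (n : ℕ) : Measurable fun ω => trimmedMeanDiff α β n (fun i => D i ω) := by
  simp only [trimmedMeanDiff_eq hα hβ hαβ]
  exact ((measurable_integral_quantile hD true n hα (by linarith) (by linarith)).sub
    (measurable_integral_quantile hD false n hα (by linarith) (by linarith))).const_mul _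

end Measurability

/-! ### Convergence in measure to zero -/

section ConvergenceInMeasure

variable {Ω : Type*} [MeasurableSpace Ω] {P : Measure Ω}

theorem tendstoInMeasure_zero_of_abs_le {X X₁ X₂ : ℕ → Ω → ℝ} {c : ℝ} (hc : 0 < c)
    (h₁ : TendstoInMeasure P X₁ atTop fun _ => (0 : ℝ))
    (h₂ : TendstoInMeasure P X₂ atTop fun _ => (0 : ℝ))
    (h : ∀ n ω, |X n ω| ≤ c * (|X₁ n ω| + |X₂ n ω|)) :
    TendstoInMeasure P X atTop fun _ => (0 : ℝ) := by
  rw [tendstoInMeasure_iff_norm] at h₁ h₂ ⊢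
  intro ε hε
  have hε' : 0 < ε / (2 * c) := by positivity
  have hs := (h₁ _ hε').add (h₂ _ hε')
  rw [add_zero] at hs
  refine tendsto_of_tendsto_of_tendsto_of_le_of_le tendsto_const_nhds hs (fun _ => zero_le)
    fun n => le_trans (measure_mono fun ω hω => ?_) (measure_union_le _ _)
  simp only [sub_zero, Real.norm_eq_abs, Set.mem_ofPred_eq, Set.mem_union] at hω ⊢
  by_contra! hcon
  have e : c * (ε / (2 * c) + ε / (2 * c)) = ε := by field_simp; ring
  have := (hω.trans (h n ω)).trans_lt (mul_lt_mul_of_pos_left (add_lt_add hcon.1 hcon.2) hc)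
  linarith

theorem tendstoInMeasure_abs_add_abs {X₁ X₂ : ℕ → Ω → ℝ}
    (h₁ : TendstoInMeasure P X₁ atTop fun _ => (0 : ℝ))
    (h₂ : TendstoInMeasure P X₂ atTop fun _ => (0 : ℝ)) :
    TendstoInMeasure P (fun n ω => |X₁ n ω| + |X₂ n ω|) atTop fun _ => (0 : ℝ) :=
  tendstoInMeasure_zero_of_abs_le one_pos h₁ h₂ fun n ω => by
    rw [one_mul, abs_of_nonneg (add_nonneg (abs_nonneg _) (abs_nonneg _))]

variable [IsProbabilityMeasure P]

/-- The product of a sequence with bounded second moments and a sequence which tends to zero almost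
surely tends to zero in measure. -/
theorem tendstoInMeasure_mul_zero {U V : ℕ → Ω → ℝ} {C : ℝ}
    (hU : ∀ n, Integrable (fun ω => U n ω ^ 2) P) (hUC : ∀ n, ∫ ω, U n ω ^ 2 ∂P ≤ C)
    (hV : ∀ n, AEStronglyMeasurable (V n) P) (hV0 : ∀ᵐ ω ∂P, Tendsto (fun n => V n ω) atTop (𝓝 0)) :
    TendstoInMeasure P (fun n ω => U n ω * V n ω) atTop fun _ => (0 : ℝ) := by
  have hVm : TendstoInMeasure P V atTop fun _ => (0 : ℝ) := tendstoInMeasure_of_tendsto_ae hV hV0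
  rw [tendstoInMeasure_iff_measureReal_norm] at hVm ⊢
  intro ε hε
  rw [Metric.tendsto_atTop]
  intro η hη
  have hC : 0 ≤ C := (integral_nonneg fun ω => sq_nonneg _).trans (hUC 0)
  -- Markov's inequality for `U²` at level `M` leaves probability below `η / 2`; the added `1` keeps
  -- `M` positive when `C = 0`.
  obtain ⟨M, hM0, hM⟩ : ∃ M : ℝ, 0 < M ∧ C / M < η / 2 :=
    ⟨2 * C / η + 1, by positivity, by
      rw [div_lt_iff₀ (by positivity)]
      have : η / 2 * (2 * C / η + 1) = C + η / 2 := by field_simp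
      linarith⟩
  have hsM : 0 < √M := Real.sqrt_pos.2 hM0
  obtain ⟨N, hN⟩ := Metric.tendsto_atTop.1 (hVm (ε / √M) (by positivity)) (η / 2) (by positivity)
  refine ⟨N, fun n hn => ?_⟩
  have h1 := hN n hn
  rw [Real.dist_eq, sub_zero, abs_of_nonneg measureReal_nonneg] at h1 ⊢
  have h2 : P.real {ω | M ≤ U n ω ^ 2} ≤ C / M := by
    rw [le_div_iff₀ hM0, mul_comm]
    exact (mul_meas_ge_le_integral_of_nonneg (Eventually.of_forall fun ω => sq_nonneg _) (hU n)
      M).trans (hUC n)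
  have hsub : {ω | ε ≤ ‖U n ω * V n ω - 0‖}
      ⊆ {ω | M ≤ U n ω ^ 2} ∪ {ω | ε / √M ≤ ‖V n ω - 0‖} := by
    intro ω hω
    simp only [sub_zero, Set.mem_ofPred_eq, Set.mem_union, norm_mul, Real.norm_eq_abs] at hω ⊢
    by_contra! hcon
    have hu : |U n ω| < √M := by
      rw [← Real.sqrt_sq_eq_abs]
      exact Real.sqrt_lt_sqrt (sq_nonneg _) hcon.1
    have : |U n ω| * |V n ω| < √M * (ε / √M) :=
      mul_lt_mul'' hu hcon.2 (abs_nonneg _) (abs_nonneg _)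
    rw [mul_div_cancel₀ _ hsM.ne'] at this
    linarith
  calc _ ≤ P.real ({ω | M ≤ U n ω ^ 2} ∪ {ω | ε / √M ≤ ‖V n ω - 0‖}) := measureReal_mono hsub
    _ ≤ P.real {ω | M ≤ U n ω ^ 2} + P.real {ω | ε / √M ≤ ‖V n ω - 0‖} := measureReal_union_le _ _
    _ < η / 2 + η / 2 := add_lt_add_of_le_of_lt (h2.trans hM.le) h1
    _ = η := add_halves η

end ConvergenceInMeasure

/-! ### Random samples -/

/-- The observations `D i` are independent with common law `Q`. -/
structure IsRandomSample {Ω 𝓧 : Type*} [MeasurableSpace Ω] [MeasurableSpace 𝓧] (P : Measure Ω)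
    (D : ℕ → Ω → 𝓧) (Q : Measure 𝓧) : Prop where
  measurable : ∀ i, Measurable (D i)
  indep : iIndepFun D P
  map_eq : ∀ i, P.map (D i) = Q

namespace IsRandomSample

variable {Ω 𝓧 : Type*} [MeasurableSpace Ω] [MeasurableSpace 𝓧] {P : Measure Ω}
  {D : ℕ → Ω → 𝓧} {Q : Measure 𝓧}

theorem identDistrib (h : IsRandomSample P D Q) {φ : 𝓧 → ℝ} (hφ : Measurable φ) (i : ℕ) :
    IdentDistrib (fun ω => φ (D i ω)) (fun ω => φ (D 0 ω)) P P :=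
  IdentDistrib.comp (f := D i) (g := D 0) ⟨(h.measurable i).aemeasurable,
    (h.measurable 0).aemeasurable, by rw [h.map_eq, h.map_eq]⟩ hφ

theorem iIndepFun_comp (h : IsRandomSample P D Q) {φ : 𝓧 → ℝ} (hφ : Measurable φ) :
    iIndepFun (fun i ω => φ (D i ω)) P :=
  h.indep.comp (fun _ => φ) fun _ => hφ

theorem integral_comp (h : IsRandomSample P D Q) {φ : 𝓧 → ℝ} (hφ : Measurable φ) (i : ℕ) :
    ∫ ω, φ (D i ω) ∂P = ∫ x, φ x ∂Q := by
  rw [← h.map_eq i, integral_map (h.measurable i).aemeasurable hφ.aestronglyMeasurable]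

variable [IsProbabilityMeasure P]

theorem memLp (h : IsRandomSample P D Q) {φ : 𝓧 → ℝ} (hφ : Measurable φ) {C : ℝ}
    (hC : ∀ x, |φ x| ≤ C) (i : ℕ) : MemLp (fun ω => φ (D i ω)) 2 P :=
  MemLp.of_bound (hφ.comp (h.measurable i)).aestronglyMeasurable C
    (Eventually.of_forall fun _ => hC _)

theorem tendsto_average (h : IsRandomSample P D Q) {φ : 𝓧 → ℝ} (hφ : Measurable φ) {C : ℝ}
    (hC : ∀ x, |φ x| ≤ C) : ∀ᵐ ω ∂P, Tendsto
      (fun n : ℕ => (∑ i ∈ Finset.range n, φ (D i ω)) / n) atTop (𝓝 (∫ x, φ x ∂Q)) := by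
  have := strong_law_ae_real (fun i ω => φ (D i ω)) ((h.memLp hφ hC 0).integrable one_le_two)
    (fun i j hij => (h.iIndepFun_comp hφ).indepFun hij) (h.identDistrib hφ)
  rwa [h.integral_comp hφ 0] at this

theorem integrable_sum_div_sqrt_sq (h : IsRandomSample P D Q) {φ : 𝓧 → ℝ} (hφ : Measurable φ) {C : ℝ}
    (hC : ∀ x, |φ x| ≤ C) (n : ℕ) :
    Integrable (fun ω => ((∑ i ∈ Finset.range n, φ (D i ω)) / √n) ^ 2) P := by
  simp only [div_eq_mul_inv]
  exact ((memLp_finsetSum _ fun i _ => h.memLp hφ hC i).mul_const _).integrable_sq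

/-- Variances of independent centered terms add, so the bound is uniform in `n`, as
`tendstoInMeasure_mul_zero` requires. -/
theorem integral_sum_div_sqrt_sq_le (h : IsRandomSample P D Q) {φ : 𝓧 → ℝ} (hφ : Measurable φ) {C : ℝ}
    (hC : ∀ x, |φ x| ≤ C) (h0 : ∫ x, φ x ∂Q = 0) (n : ℕ) :
    ∫ ω, ((∑ i ∈ Finset.range n, φ (D i ω)) / √n) ^ 2 ∂P ≤ C ^ 2 := by
  have hm := fun i => h.memLp hφ hC i
  have hv : Var[∑ i ∈ Finset.range n, fun ω => φ (D i ω); P]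
      = ∑ i ∈ Finset.range n, Var[fun ω => φ (D i ω); P] :=
    IndepFun.variance_sum (fun i _ => hm i) fun i _ j _ hij => (h.iIndepFun_comp hφ).indepFun hij
  have hmean : ∀ i, ∫ ω, φ (D i ω) ∂P = 0 := fun i => by rw [h.integral_comp hφ, h0]
  have hvi : ∀ i, Var[fun ω => φ (D i ω); P] ≤ C ^ 2 := by
    intro i
    rw [variance_of_integral_eq_zero (hm i).1.aemeasurable (hmean i)]
    calc ∫ ω, φ (D i ω) ^ 2 ∂P ≤ ∫ _, C ^ 2 ∂P :=
          integral_mono (hm i).integrable_sq (integrable_const _) fun ω => by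
            rw [← sq_abs]; exact pow_le_pow_left₀ (abs_nonneg _) (hC _) 2
      _ = C ^ 2 := by simp
  have hsum : ∫ ω, (∑ i ∈ Finset.range n, fun ω => φ (D i ω)) ω ∂P = 0 := by
    simp only [Finset.sum_apply]
    rw [integral_finsetSum _ fun i _ => (hm i).integrable one_le_two]
    simp [hmean]
  rw [variance_of_integral_eq_zero
    (memLp_finsetSum' _ fun i _ => hm i).1.aemeasurable hsum] at hv
  simp only [Finset.sum_apply] at hv
  simp only [div_pow, Real.sq_sqrt (Nat.cast_nonneg n)]
  rw [integral_div, hv]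
  refine div_le_of_le_mul₀ (Nat.cast_nonneg n) (sq_nonneg _) ?_
  calc ∑ i ∈ Finset.range n, Var[fun ω => φ (D i ω); P] ≤ ∑ i ∈ Finset.range n, C ^ 2 :=
        Finset.sum_le_sum fun i _ => hvi i
    _ = C ^ 2 * n := by simp [mul_comm]

theorem tendstoInDistribution_sum_div_sqrt (h : IsRandomSample P D Q) {φ : 𝓧 → ℝ} (hφ : Measurable φ)
    {C : ℝ} (hC : ∀ x, |φ x| ≤ C) (h0 : ∫ x, φ x ∂Q = 0) {v : ℝ} (hv : ∫ x, φ x ^ 2 ∂Q = v) :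
    TendstoInDistribution (fun (n : ℕ) ω => (∑ i ∈ Finset.range n, φ (D i ω)) / √n) atTop
      (id : ℝ → ℝ) (fun _ => P) (gaussianReal 0 v.toNNReal) := by
  have hvar : Var[fun ω => φ (D 0 ω); P] = v := by
    rw [variance_of_integral_eq_zero (h.memLp hφ hC 0).1.aemeasurable
      (by rw [h.integral_comp hφ, h0]), ← hv]
    exact h.integral_comp (hφ.pow_const 2) 0
  have := tendstoInDistribution_inv_sqrt_mul_sum_sub (P := P) (X := fun i ω => φ (D i ω))
    (P' := gaussianReal 0 v.toNNReal) (Y := id)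
    ⟨aemeasurable_id, by rw [Measure.map_id, hvar]⟩ (h.memLp hφ hC 0) (h.iIndepFun_comp hφ)
    (h.identDistrib hφ)
  rw [h.integral_comp hφ, h0] at this
  simpa only [mul_zero, sub_zero, inv_mul_eq_div] using this

end IsRandomSample

/-! ### The observed data of a randomized experiment -/

section Experiment

variable {Ω : Type*} [MeasurableSpace Ω] {P : Measure Ω} [IsProbabilityMeasure P] {p τ : ℝ}
  {Z : ℕ → Ω → Bool} {Y0 Y1 : ℕ → Ω → ℝ} {f S : ℝ → ℝ} {K : ℝ}

/-- Splitting along the assignment, each arm sees only one potential outcome, independent of `Z i`.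
The joint law of `(Y0, Y1)` plays no role beyond its marginals. -/
theorem IsRandomizedExperiment.map_observed (hexp : IsRandomizedExperiment P p Z Y0 Y1)
    (h : HasLipschitzScore f S K) (hp0 : 0 ≤ p) (hp1 : p ≤ 1)
    (hY0 : ∀ i, P.map (Y0 i) = densityMeasure f)
    (hY1 : ∀ i, P.map (Y1 i) = (densityMeasure f).map (fun y => y + τ)) (i : ℕ)
    (hD : Measurable (observed Z Y0 Y1 i)) :
    P.map (observed Z Y0 Y1 i) = additiveLaw p f τ := by
  have hmZ := hexp.measurable_Z i
  have hm0 := hexp.measurable_Y0 i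
  have hm1 := hexp.measurable_Y1 i
  have hZt : P (Z i ⁻¹' {true}) = ENNReal.ofReal p := by
    rw [← hexp.treated_prob i, ofReal_measureReal]
    rfl
  have hZf : P (Z i ⁻¹' {false}) = ENNReal.ofReal (1 - p) := by
    have : Z i ⁻¹' {false} = (Z i ⁻¹' {true})ᶜ := by
      ext ω; simp
    rw [this, prob_compl_eq_one_sub (hmZ (measurableSet_singleton _)), hZt,
      ENNReal.ofReal_sub _ hp0, ENNReal.ofReal_one]
  ext s hs
  have hst : MeasurableSet (Prod.mk true ⁻¹' s : Set ℝ) := measurable_prodMk_left hs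
  have hsf : MeasurableSet (Prod.mk false ⁻¹' s : Set ℝ) := measurable_prodMk_left hs
  have hsplit : observed Z Y0 Y1 i ⁻¹' s
      = (Z i ⁻¹' {true} ∩ Y1 i ⁻¹' (Prod.mk true ⁻¹' s))
        ∪ (Z i ⁻¹' {false} ∩ Y0 i ⁻¹' (Prod.mk false ⁻¹' s)) := by
    ext ω
    by_cases hz : Z i ω = true <;> simp [observed, hz]
  have hdisj : Disjoint (Z i ⁻¹' {true} ∩ Y1 i ⁻¹' (Prod.mk true ⁻¹' s))
      (Z i ⁻¹' {false} ∩ Y0 i ⁻¹' (Prod.mk false ⁻¹' s)) := by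
    refine Set.disjoint_left.2 fun ω h1 h2 => ?_
    have e1 : Z i ω = true := h1.1
    have e2 : Z i ω = false := h2.1
    simp [e1] at e2
  have ind1 : IndepFun (Z i) (Y1 i) P := (hexp.randomized i).comp measurable_id measurable_snd
  have ind0 : IndepFun (Z i) (Y0 i) P := (hexp.randomized i).comp measurable_id measurable_fst
  rw [Measure.map_apply hD hs, hsplit,
    measure_union hdisj ((hmZ (measurableSet_singleton _)).inter (hm0 hsf)),
    ind1.measure_inter_preimage_eq_mul _ _ (measurableSet_singleton _) hst,
    ind0.measure_inter_preimage_eq_mul _ _ (measurableSet_singleton _) hsf, hZt, hZf,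
    ← Measure.map_apply hm1 hst, ← Measure.map_apply hm0 hsf, hY0, hY1,
    Measure.map_apply (measurable_add_const τ) hst, additiveLaw_eq hp0 hp1 h.continuous]
  simp only [Measure.coe_add, Measure.coe_smul, Pi.add_apply, Pi.smul_apply, smul_eq_mul]
  rw [Measure.map_apply (measurable_prodMk_add τ) hs, Measure.map_apply measurable_prodMk_left hs]
  rfl

theorem IsRandomizedExperiment.isRandomSample (hexp : IsRandomizedExperiment P p Z Y0 Y1)
    (h : HasLipschitzScore f S K) (hp0 : 0 ≤ p) (hp1 : p ≤ 1)
    (hY0 : ∀ i, P.map (Y0 i) = densityMeasure f)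
    (hY1 : ∀ i, P.map (Y1 i) = (densityMeasure f).map (fun y => y + τ)) :
    IsRandomSample P (observed Z Y0 Y1) (additiveLaw p f τ) := by
  have hG : Measurable fun x : Bool × ℝ × ℝ => (x.1, if x.1 = true then x.2.2 else x.2.1) :=
    measurable_fst.prodMk (Measurable.ite (measurable_fst (measurableSet_singleton true))
      (measurable_snd.comp measurable_snd) (measurable_fst.comp measurable_snd))
  have hD : ∀ i, Measurable (observed Z Y0 Y1 i) := fun i =>
    hG.comp ((hexp.measurable_Z i).prodMk ((hexp.measurable_Y0 i).prodMk (hexp.measurable_Y1 i)))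
  exact ⟨hD, hexp.indep.comp (fun _ => _) fun _ => hG,
    fun i => hexp.map_observed h hp0 hp1 hY0 hY1 i (hD i)⟩

end Experiment

/-! ### Asymptotics of the arms -/

/-- The probability of the arm `z`. -/
def armProb (p : ℝ) (z : Bool) : ℝ := if z = true then p else 1 - p

/-- The shift of the outcomes in the arm `z`. -/
def armShift (τ : ℝ) (z : Bool) : ℝ := if z = true then τ else 0

theorem armProb_pos {p : ℝ} (hp0 : 0 < p) (hp1 : p < 1) (z : Bool) : 0 < armProb p z := by
  cases z
  · simpa [armProb] using hp1
  · simpa [armProb] using hp0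

namespace HasLipschitzScore

variable {f S : ℝ → ℝ} {K p τ : ℝ}

theorem measurable_arm {φ : ℝ → ℝ} (hφ : Measurable φ) (z : Bool) :
    Measurable fun w : Bool × ℝ => if w.1 = z then φ w.2 else 0 :=
  Measurable.ite (measurable_fst (measurableSet_singleton z)) (hφ.comp measurable_snd)
    measurable_const

theorem abs_arm_le {φ : ℝ → ℝ} {C : ℝ} (hC : ∀ y, |φ y| ≤ C) (z : Bool) (w : Bool × ℝ) :
    |if w.1 = z then φ w.2 else 0| ≤ C := by
  split_ifs
  · exact hC _
  · simpa using (abs_nonneg _).trans (hC 0)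

theorem integral_arm (h : HasLipschitzScore f S K) (hp0 : 0 < p) (hp1 : p < 1) {φ : ℝ → ℝ}
    (hφ : Measurable φ) {C : ℝ} (hC : ∀ y, |φ y| ≤ C) (z : Bool) :
    ∫ w, (if w.1 = z then φ w.2 else 0) ∂(additiveLaw p f τ)
      = armProb p z * ∫ y, φ (y + armShift τ z) * f y := by
  have := h.isProbabilityMeasure_additiveLaw hp0.le hp1.le τ
  rw [integral_additiveLaw hp0 hp1 h.continuous (fun x => (h.pos x).le) τ
    (Integrable.of_bound (measurable_arm hφ z).aestronglyMeasurable C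
      (Eventually.of_forall fun w => abs_arm_le hC z w))]
  cases z <;> simp [armProb, armShift]

variable {Ω : Type*} [MeasurableSpace Ω] {P : Measure Ω} [IsProbabilityMeasure P]
  {D : ℕ → Ω → Bool × ℝ}

theorem tendsto_armSum_div (h : HasLipschitzScore f S K) (hp0 : 0 < p) (hp1 : p < 1)
    (hD : IsRandomSample P D (additiveLaw p f τ)) {φ : ℝ → ℝ} (hφ : Measurable φ) {C : ℝ}
    (hC : ∀ y, |φ y| ≤ C) (z : Bool) :
    ∀ᵐ ω ∂P, Tendsto (fun n : ℕ => armSum z φ n (fun i => D i ω) / n) atTop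
      (𝓝 (armProb p z * ∫ y, φ (y + armShift τ z) * f y)) := by
  have := hD.tendsto_average (measurable_arm hφ z) (abs_arm_le hC z)
  rwa [h.integral_arm hp0 hp1 hφ hC] at this

theorem tendsto_armSize_div (h : HasLipschitzScore f S K) (hp0 : 0 < p) (hp1 : p < 1)
    (hD : IsRandomSample P D (additiveLaw p f τ)) (z : Bool) :
    ∀ᵐ ω ∂P, Tendsto (fun n : ℕ => (armSize z n (fun i => D i ω) : ℝ) / n) atTop
      (𝓝 (armProb p z)) := by
  have := h.tendsto_armSum_div hp0 hp1 hD (φ := fun _ => 1) measurable_const (C := 1) (by simp) z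
  simpa [armSize_eq_armSum, h.integral_eq_one] using this

theorem eventually_armSize_ne_zero (h : HasLipschitzScore f S K) (hp0 : 0 < p) (hp1 : p < 1)
    (hD : IsRandomSample P D (additiveLaw p f τ)) (z : Bool) :
    ∀ᵐ ω ∂P, ∀ᶠ n in atTop, armSize z n (fun i => D i ω) ≠ 0 := by
  filter_upwards [h.tendsto_armSize_div hp0 hp1 hD z] with ω hω
  filter_upwards [hω.eventually (Ioi_mem_nhds (armProb_pos hp0 hp1 z))] with n hn h0
  simp [h0] at hn

theorem tendsto_div_armSize (h : HasLipschitzScore f S K) (hp0 : 0 < p) (hp1 : p < 1)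
    (hD : IsRandomSample P D (additiveLaw p f τ)) (z : Bool) :
    ∀ᵐ ω ∂P, Tendsto (fun n : ℕ => (n : ℝ) / armSize z n (fun i => D i ω)) atTop
      (𝓝 (armProb p z)⁻¹) := by
  filter_upwards [h.tendsto_armSize_div hp0 hp1 hD z] with ω hω
  simpa only [inv_div] using hω.inv₀ (armProb_pos hp0 hp1 z).ne'

theorem integral_indicator_Iic_add_mul (h : HasLipschitzScore f S K) (x s : ℝ) :
    ∫ y, (Set.Iic x).indicator (1 : ℝ → ℝ) (y + s) * f y = densityCDF f (x - s) := by
  rw [h.densityCDF_eq, ← integral_indicator measurableSet_Iic]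
  refine integral_congr_ae (Eventually.of_forall fun y => ?_)
  by_cases hy : y ≤ x - s
  · have hy' : y + s ≤ x := by linarith
    simp [Set.indicator, hy, hy']
  · have hy' : ¬y + s ≤ x := fun h' => hy (by linarith)
    simp [Set.indicator, hy, hy']

theorem abs_indicator_one_le (s : Set ℝ) (y : ℝ) : |s.indicator (1 : ℝ → ℝ) y| ≤ 1 := by
  by_cases hy : y ∈ s <;> simp [hy]

theorem tendsto_empiricalCDF (h : HasLipschitzScore f S K) (hp0 : 0 < p) (hp1 : p < 1)
    (hD : IsRandomSample P D (additiveLaw p f τ)) (z : Bool) (x : ℝ) :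
    ∀ᵐ ω ∂P, Tendsto (fun n : ℕ => empiricalCDF z n (fun i => D i ω) x) atTop
      (𝓝 (densityCDF f (x - armShift τ z))) := by
  have hp := armProb_pos hp0 hp1 z
  filter_upwards [h.tendsto_armSum_div hp0 hp1 hD (φ := (Set.Iic x).indicator 1)
    (measurable_one.indicator measurableSet_Iic) (abs_indicator_one_le _) z,
    h.tendsto_div_armSize hp0 hp1 hD z] with ω h1 h2
  rw [h.integral_indicator_Iic_add_mul] at h1
  have h3 := h1.mul h2
  rw [mul_comm (armProb p z), mul_inv_cancel_right₀ hp.ne'] at h3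
  refine h3.congr' ?_
  filter_upwards [eventually_ge_atTop 1] with n hn
  have : (n : ℝ) ≠ 0 := by positivity
  rw [empiricalCDF_eq_div, div_mul_div_cancel₀ this]

/-- The strong law at the points `a + s ± 1/(k+1)` holds for all `k` outside one null set. Strict
monotonicity of the distribution function separates these limits from the level, which traps the
empirical quantile between the points. -/
theorem tendsto_quantile_empiricalCDF (h : HasLipschitzScore f S K) (hp0 : 0 < p) (hp1 : p < 1)
    (hD : IsRandomSample P D (additiveLaw p f τ)) (z : Bool) (a : ℝ) :
    ∀ᵐ ω ∂P, Tendsto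
      (fun n : ℕ => quantile (empiricalCDF z n (fun i => D i ω)) (densityCDF f a)) atTop
      (𝓝 (a + armShift τ z)) := by
  set s := armShift τ z with hs
  have hlow : ∀ᵐ ω ∂P, ∀ k : ℕ, Tendsto
      (fun n : ℕ => empiricalCDF z n (fun i => D i ω) (a + s - 1 / ((k : ℝ) + 1))) atTop
      (𝓝 (densityCDF f (a - 1 / ((k : ℝ) + 1)))) := by
    rw [ae_all_iff]
    intro k
    have := h.tendsto_empiricalCDF hp0 hp1 hD z (a + s - 1 / ((k : ℝ) + 1))
    rwa [show a + s - 1 / ((k : ℝ) + 1) - armShift τ z = a - 1 / ((k : ℝ) + 1) by ring] at this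
  have hupp : ∀ᵐ ω ∂P, ∀ k : ℕ, Tendsto
      (fun n : ℕ => empiricalCDF z n (fun i => D i ω) (a + s + 1 / ((k : ℝ) + 1))) atTop
      (𝓝 (densityCDF f (a + 1 / ((k : ℝ) + 1)))) := by
    rw [ae_all_iff]
    intro k
    have := h.tendsto_empiricalCDF hp0 hp1 hD z (a + s + 1 / ((k : ℝ) + 1))
    rwa [show a + s + 1 / ((k : ℝ) + 1) - armShift τ z = a + 1 / ((k : ℝ) + 1) by ring] at this
  filter_upwards [hlow, hupp, h.eventually_armSize_ne_zero hp0 hp1 hD z] with ω h1 h2 h3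
  rw [Metric.tendsto_atTop']
  intro ε hε
  obtain ⟨k, hk⟩ := exists_nat_one_div_lt hε
  have hk0 : 0 < 1 / ((k : ℝ) + 1) := by positivity
  have e1 := (h1 k).eventually (Iio_mem_nhds (h.densityCDF_strictMono (sub_lt_self a hk0)))
  have e2 := (h2 k).eventually (Ioi_mem_nhds (h.densityCDF_strictMono (lt_add_of_pos_right a hk0)))
  obtain ⟨N, hN⟩ := eventually_atTop.1 (e1.and (e2.and h3))
  refine ⟨N, fun n hn => ?_⟩
  obtain ⟨g1, g2, g3⟩ := hN n hn.le
  have gal := quantile_empiricalCDF_le_iff g3 (h.densityCDF_pos a) (h.densityCDF_lt_one a)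
  have l1 : a + s - 1 / ((k : ℝ) + 1) < quantile (empiricalCDF z n (fun i => D i ω)) (densityCDF f a) :=
    not_le.1 fun hle => absurd ((gal _).1 hle) (not_le.2 g1)
  have l2 := (gal _).2 (le_of_lt g2)
  rw [Real.dist_eq, abs_lt]
  constructor <;> linarith

/-- Root-`n` fluctuations of a centered arm sum are negligible after multiplication with a sequence
which tends to zero. -/
theorem tendstoInMeasure_armSum_mul (h : HasLipschitzScore f S K) (hp0 : 0 < p) (hp1 : p < 1)
    (hD : IsRandomSample P D (additiveLaw p f τ)) {φ : ℝ → ℝ} (hφ : Measurable φ) {C : ℝ}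
    (hC : ∀ y, |φ y| ≤ C) (z : Bool) (h0 : ∫ y, φ (y + armShift τ z) * f y = 0)
    {V : ℕ → Ω → ℝ} (hV : ∀ n, Measurable (V n))
    (hV0 : ∀ᵐ ω ∂P, Tendsto (fun n => V n ω) atTop (𝓝 0)) :
    TendstoInMeasure P (fun n ω => armSum z φ n (fun i => D i ω) / √(n : ℝ) * V n ω) atTop
      fun _ => (0 : ℝ) := by
  have h1 := hD.integrable_sum_div_sqrt_sq (measurable_arm hφ z) (abs_arm_le hC z)
  have h2 := hD.integral_sum_div_sqrt_sq_le (measurable_arm hφ z) (abs_arm_le hC z)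
    (by rw [h.integral_arm hp0 hp1 hφ hC, h0, mul_zero])
  unfold armSum
  exact tendstoInMeasure_mul_zero h1 h2 (fun n => (hV n).aestronglyMeasurable) hV0

theorem armSum_sub_const {z : Bool} {n : ℕ} {d : ℕ → Bool × ℝ} (φ : ℝ → ℝ) (c : ℝ) :
    armSum z (fun y => φ y - c) n d = armSum z φ n d - c * armSize z n d := by
  rw [armSize_eq_armSum, armSum, armSum, armSum, Finset.mul_sum, ← Finset.sum_sub_distrib]
  refine Finset.sum_congr rfl fun i _ => ?_
  split_ifs <;> simp

/-- A deterministic bound for the error of the linearization of the integrated empirical quantile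
function of an arm. -/
theorem abs_sqrt_mul_integral_quantile_sub_le {z : Bool} {n : ℕ} {d : ℕ → Bool × ℝ}
    (hN : armSize z n d ≠ 0) {α γ a b : ℝ} (hα : 0 < α) (hαγ : α < γ) (hγ : γ < 1) (hab : a ≤ b)
    (m s r : ℝ) :
    |√(n : ℝ) * ((∫ u in α..γ, quantile (empiricalCDF z n d) u)
          - (m + s - α * (a + s) - (1 - γ) * (b + s)))
        - armSum z (fun y => max a (min b (y - s)) - m) n d / √(n : ℝ) * r|
      ≤ |armSum z (fun y => max a (min b (y - s)) - m) n d / √(n : ℝ)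
            * ((n : ℝ) / armSize z n d - r)|
        + (|armSum z (fun y => (Set.Iic (a + s)).indicator 1 y - α) n d / √(n : ℝ)
              * ((quantile (empiricalCDF z n d) α - (a + s)) * ((n : ℝ) / armSize z n d))|
          + |armSum z (fun y => (Set.Iic (b + s)).indicator 1 y - γ) n d / √(n : ℝ)
              * ((quantile (empiricalCDF z n d) γ - (b + s)) * ((n : ℝ) / armSize z n d))|) := by
  set W : ℝ → ℝ := fun y => max a (min b (y - s)) - m with hW
  have hn : 0 < n := by
    rcases Nat.eq_zero_or_pos n with rfl | hn
    · simp [armSize] at hN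
    · exact hn
  have hN' : (armSize z n d : ℝ) ≠ 0 := by exact_mod_cast hN
  have hn' : (0 : ℝ) < n := by exact_mod_cast hn
  have hsn : 0 < √(n : ℝ) := Real.sqrt_pos.2 hn'
  -- Trades the random arm size for the deterministic scaling `1 / √n` and the factor `n / armSize`,
  -- which converges almost surely.
  have hscale : ∀ x : ℝ, √(n : ℝ) * (x / armSize z n d)
      = x / √(n : ℝ) * ((n : ℝ) / armSize z n d) := fun x => by
    field_simp
    rw [Real.sq_sqrt hn'.le, mul_comm]
  have hclip : ∀ y, max (a + s) (min (b + s) y) - (m + s) = W y := fun y => by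
    have : max (a + s) (min (b + s) y) = max a (min b (y - s)) + s := by
      rw [max_add, min_add, sub_add_cancel]
    rw [this, hW]
    ring
  have hcs : armSum z (fun y => max (a + s) (min (b + s) y)) n d
      = armSum z W n d + (m + s) * armSize z n d := by
    have := armSum_sub_const (z := z) (n := n) (d := d)
      (fun y => max (a + s) (min (b + s) y)) (m + s)
    simp only [hclip] at this
    linarith
  have hb := abs_integral_quantile_empiricalCDF_sub_le (a := a + s) (b := b + s) hN hα hαγ hγ
    (by linarith)
  rw [hcs, add_div, mul_div_cancel_right₀ _ hN'] at hb
  have hterm : ∀ x c q : ℝ, √(n : ℝ) * (|q| * |empiricalCDF z n d x - c|)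
      = |armSum z (fun y => (Set.Iic x).indicator 1 y - c) n d / √(n : ℝ)
        * (q * ((n : ℝ) / armSize z n d))| := fun x c q => by
    have hF : empiricalCDF z n d x - c
        = armSum z (fun y => (Set.Iic x).indicator 1 y - c) n d / armSize z n d := by
      rw [armSum_sub_const, sub_div, mul_div_cancel_right₀ _ hN', ← empiricalCDF_eq_div]
    rw [hF, mul_left_comm (_ / √(n : ℝ)), ← hscale, abs_mul, abs_mul, abs_of_pos hsn]
    ring
  -- The error splits into the replacement of `n / armSize` by `r` and `√n` times the remainder of
  -- the quantile linearization.
  have e : √(n : ℝ) * ((∫ u in α..γ, quantile (empiricalCDF z n d) u)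
          - (m + s - α * (a + s) - (1 - γ) * (b + s))) - armSum z W n d / √(n : ℝ) * r
      = armSum z W n d / √(n : ℝ) * ((n : ℝ) / armSize z n d - r)
        + √(n : ℝ) * ((∫ u in α..γ, quantile (empiricalCDF z n d) u)
          - (armSum z W n d / armSize z n d + (m + s) - α * (a + s) - (1 - γ) * (b + s))) := by
    linear_combination hscale (armSum z W n d)
  rw [e, ← hterm, ← hterm, ← mul_add]
  refine (abs_add_le _ _).trans (add_le_add_right ?_ _)
  rw [abs_mul, abs_of_pos hsn]
  exact mul_le_mul_of_nonneg_left hb hsn.le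

/-- Each of the two terms of the remainder of the linearization is of smaller order than
`1 / √n`. -/
theorem tendstoInMeasure_quantile_mul_empiricalCDF (h : HasLipschitzScore f S K) (hp0 : 0 < p)
    (hp1 : p < 1) (hD : IsRandomSample P D (additiveLaw p f τ)) (z : Bool) (a : ℝ) :
    TendstoInMeasure P (fun n ω =>
      armSum z (fun y => (Set.Iic (a + armShift τ z)).indicator 1 y - densityCDF f a) n
          (fun i => D i ω) / √(n : ℝ) *
        ((quantile (empiricalCDF z n (fun i => D i ω)) (densityCDF f a) - (a + armShift τ z))
          * ((n : ℝ) / armSize z n (fun i => D i ω)))) atTop fun _ => (0 : ℝ) := by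
  have hm : Measurable fun y =>
      (Set.Iic (a + armShift τ z)).indicator (1 : ℝ → ℝ) y - densityCDF f a :=
    (measurable_one.indicator measurableSet_Iic).sub_const _
  refine h.tendstoInMeasure_armSum_mul hp0 hp1 hD hm (C := 2) (fun y => ?_) z ?_ (fun n => ?_) ?_
  · have h1 := abs_indicator_one_le (Set.Iic (a + armShift τ z)) y
    have h2 := abs_of_pos (h.densityCDF_pos a)
    have h3 := h.densityCDF_lt_one a
    exact (abs_sub _ _).trans (by linarith)
  · simp only [sub_mul]
    have hi : Integrable fun y =>
        (Set.Iic (a + armShift τ z)).indicator (1 : ℝ → ℝ) (y + armShift τ z) * f y :=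
      h.integrable_bounded_mul (C := 1)
        ((measurable_one.indicator measurableSet_Iic).comp
          (measurable_add_const _)).aestronglyMeasurable fun y => abs_indicator_one_le _ _
    rw [integral_sub hi (h.integrable.const_mul _), h.integral_indicator_Iic_add_mul, integral_const_mul,
      h.integral_eq_one, add_sub_cancel_right, mul_one, sub_self]
  · refine ((measurable_quantile_empiricalCDF_const hD.measurable z n (h.densityCDF_pos a)
      (h.densityCDF_lt_one a)).sub_const _).mul ?_
    simp only [armSize_eq_armSum]
    exact measurable_const.div (measurable_armSum hD.measurable z measurable_const n)
  · filter_upwards [h.tendsto_quantile_empiricalCDF hp0 hp1 hD z a,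
      h.tendsto_div_armSize hp0 hp1 hD z] with ω h1 h2
    have := (h1.sub_const (a + armShift τ z)).mul h2
    rwa [sub_self, zero_mul] at this

/-- Asymptotic linearity of the integrated empirical quantile function of an arm. -/
theorem tendstoInMeasure_integral_quantile (h : HasLipschitzScore f S K) (hp0 : 0 < p) (hp1 : p < 1)
    (hD : IsRandomSample P D (additiveLaw p f τ)) (z : Bool) {a b m : ℝ} (hab : a < b)
    (hm : ∫ y, (max a (min b y) - m) * f y = 0) :
    TendstoInMeasure P (fun (n : ℕ) ω =>
      √(n : ℝ) * ((∫ u in densityCDF f a..densityCDF f b,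
          quantile (empiricalCDF z n (fun i => D i ω)) u)
        - (m + armShift τ z - densityCDF f a * (a + armShift τ z)
          - (1 - densityCDF f b) * (b + armShift τ z)))
        - armSum z (fun y => max a (min b (y - armShift τ z)) - m) n (fun i => D i ω)
          / √(n : ℝ) * (armProb p z)⁻¹) atTop fun _ => (0 : ℝ) := by
  set s := armShift τ z with hs
  set α := densityCDF f a with hα
  set γ := densityCDF f b with hγ
  have hα0 : 0 < α := h.densityCDF_pos a
  have hγ1 : γ < 1 := h.densityCDF_lt_one b
  have hαγ : α < γ := h.densityCDF_strictMono hab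
  set W : ℝ → ℝ := fun y => max a (min b (y - s)) - m with hW
  have hWm : Measurable W := by
    have : Continuous W := by fun_prop
    exact this.measurable
  have hWC : ∀ y, |W y| ≤ max |a| |b| + |m| := fun y =>
    (abs_sub _ _).trans (add_le_add_left (abs_le_max_abs_abs (le_max_left _ _)
      (max_le hab.le (min_le_left _ _))) _)
  set X := fun (n : ℕ) ω => √(n : ℝ) * ((∫ u in α..γ,
      quantile (empiricalCDF z n (fun i => D i ω)) u) - (m + s - α * (a + s) - (1 - γ) * (b + s)))
    - armSum z W n (fun i => D i ω) / √(n : ℝ) * (armProb p z)⁻¹ with hX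
  have hXm : ∀ n, Measurable (X n) := fun n =>
    (((measurable_integral_quantile hD.measurable z n hα0 hαγ.le hγ1).sub_const _).const_mul _).sub
      (((measurable_armSum hD.measurable z hWm n).div_const _).mul_const _)
  -- the event that the arm is empty
  have T0 : TendstoInMeasure P (fun n ω => {ω | armSize z n (fun i => D i ω) = 0}.indicator (X n) ω)
      atTop fun _ => (0 : ℝ) := by
    refine tendstoInMeasure_of_tendsto_ae (fun n => ((hXm n).indicator
      (measurableSet_armSize_eq_zero hD.measurable z n)).aestronglyMeasurable) ?_
    filter_upwards [h.eventually_armSize_ne_zero hp0 hp1 hD z] with ω hω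
    refine tendsto_const_nhds.congr' ?_
    filter_upwards [hω] with n hn
    rw [Set.indicator_of_notMem]
    exact hn
  -- The cost of replacing `n / armSize` by the inverse arm probability.
  have T1 := h.tendstoInMeasure_armSum_mul hp0 hp1 hD hWm hWC z
    (by simpa only [hW, ← hs, add_sub_cancel_right] using hm)
    (V := fun n ω => (n : ℝ) / armSize z n (fun i => D i ω) - (armProb p z)⁻¹)
    (fun n => by
      simp only [armSize_eq_armSum]
      exact (measurable_const.div (measurable_armSum hD.measurable z measurable_const n)).sub_const _)
    (by
      filter_upwards [h.tendsto_div_armSize hp0 hp1 hD z] with ω hω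
      simpa using hω.sub_const (armProb p z)⁻¹)
  have T2 := h.tendstoInMeasure_quantile_mul_empiricalCDF hp0 hp1 hD z a
  have T3 := h.tendstoInMeasure_quantile_mul_empiricalCDF hp0 hp1 hD z b
  rw [← hs, ← hα] at T2
  rw [← hs, ← hγ] at T3
  refine tendstoInMeasure_zero_of_abs_le one_pos T0
    (tendstoInMeasure_abs_add_abs T1 (tendstoInMeasure_abs_add_abs T2 T3)) fun n ω => ?_
  rw [one_mul]
  by_cases hN : armSize z n (fun i => D i ω) = 0
  · have : {ω | armSize z n (fun i => D i ω) = 0}.indicator (X n) ω = X n ω :=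
      Set.indicator_of_mem (s := {ω | armSize z n (fun i => D i ω) = 0}) hN _
    rw [this]
    exact le_add_of_nonneg_right (abs_nonneg _)
  · refine le_add_of_nonneg_of_le (abs_nonneg _) (le_trans ?_ (le_abs_self _))
    exact (abs_sqrt_mul_integral_quantile_sub_le hN hα0 hαγ hγ1 hab.le m s (armProb p z)⁻¹).trans
      (add_le_add_right (le_abs_self _) _)

end HasLipschitzScore

/-! ### Asymptotic linearity of the trimmed mean difference -/

section Main

variable {Ω : Type*} [MeasurableSpace Ω] {P : Measure Ω} [IsProbabilityMeasure P]
  {p τ k₁ k₂ μ σ : ℝ} {D : ℕ → Ω → Bool × ℝ}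

theorem sum_additiveInfluence {S : ℝ → ℝ} {I : ℝ} (n : ℕ) (d : ℕ → Bool × ℝ) :
    ∑ i ∈ Finset.range n, additiveInfluence p S I τ (d i)
      = (armSum false (fun y => S (y - armShift τ false)) n d * (armProb p false)⁻¹
          - armSum true (fun y => S (y - armShift τ true)) n d * (armProb p true)⁻¹) / I := by
  simp only [armSum, Finset.sum_mul, ← Finset.sum_sub_distrib, Finset.sum_div]
  refine Finset.sum_congr rfl fun i _ => ?_
  rcases hz : (d i).1 with _ | _
  · simp only [additiveInfluence, hz, armShift, armProb, reduceCtorEq, if_false, if_true, sub_zero,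
      zero_mul, div_eq_mul_inv, mul_inv]
    ring
  · simp only [additiveInfluence, hz, armShift, armProb, reduceCtorEq, if_false, if_true, zero_mul,
      div_eq_mul_inv, mul_inv]
    ring

theorem armSum_mul_const {z : Bool} {n : ℕ} {d : ℕ → Bool × ℝ} (φ : ℝ → ℝ) (c : ℝ) :
    armSum z (fun y => φ y * c) n d = armSum z φ n d * c := by
  rw [armSum, armSum, Finset.sum_mul]
  refine Finset.sum_congr rfl fun i _ => ?_
  split_ifs <;> simp

/-- The clipped observation minus `μ` is `-σ² S`, and the factor `1/(1 - α - β)` of the estimator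
turns `-σ²` into `-1/I`. So the linear terms of the two arms combine into the sum of `ψ`. -/
theorem tendstoInMeasure_trimmedMeanDiff (hp0 : 0 < p) (hp1 : p < 1) (hk₁ : 0 < k₁) (hk₂ : 0 < k₂)
    (hσ : 0 < σ) (hD : IsRandomSample P D (additiveLaw p (huberDensity k₁ k₂ μ σ) τ)) {α β : ℝ}
    (hα : α = densityCDF (huberDensity k₁ k₂ μ σ) (μ - σ * k₁))
    (hβ : 1 - β = densityCDF (huberDensity k₁ k₂ μ σ) (μ + σ * k₂)) :
    TendstoInMeasure P (fun (n : ℕ) ω =>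
      √(n : ℝ) * (trimmedMeanDiff α β n (fun i => D i ω) - τ)
        - (∑ i ∈ Finset.range n, additiveInfluence p (huberScore k₁ k₂ μ σ)
            (fisherInfo (huberDensity k₁ k₂ μ σ)) τ (D i ω)) / √(n : ℝ)) atTop
      fun _ => (0 : ℝ) := by
  have h := huberDensity_hasLipschitzScore (μ := μ) hk₁ hk₂ hσ
  have hI := fisherInfo_huberDensity (μ := μ) hk₁ hk₂ hσ
  set f := huberDensity k₁ k₂ μ σ with hf
  set a := μ - σ * k₁ with ha
  set b := μ + σ * k₂ with hb
  have hab : a < b := by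
    have := mul_pos hσ hk₁
    have := mul_pos hσ hk₂
    linarith
  have hα0 : 0 < α := hα ▸ h.densityCDF_pos a
  have hβ0 : 0 < β := by linarith [h.densityCDF_lt_one b]
  have hαβ : α + β < 1 := by linarith [h.densityCDF_strictMono hab]
  have hscore : ∀ x, huberScore k₁ k₂ μ σ x = (max a (min b x) - μ) * (-(1 / σ ^ 2)) := fun x => by
    rw [huberScore_eq_clip hσ]
    ring
  -- The clipped mean is exactly `μ`, even for an asymmetric density, because the score integrates
  -- to zero.
  have hm : ∫ y, (max a (min b y) - μ) * f y = 0 := by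
    have : ∀ y, (max a (min b y) - μ) * f y = -(σ ^ 2) * (huberScore k₁ k₂ μ σ y * f y) := fun y => by
      rw [hscore]
      field_simp
    simp only [this]
    rw [integral_const_mul, h.integral_score_mul, mul_zero]
  have T := fun z => h.tendstoInMeasure_integral_quantile hp0 hp1 hD z hab hm
  have hκ : 0 < 1 / (1 - (α + β)) := by
    have : 0 < 1 - (α + β) := by linarith
    positivity
  refine tendstoInMeasure_zero_of_abs_le hκ (T true) (T false) fun n ω => ?_
  refine le_trans (le_of_eq ?_) (mul_le_mul_of_nonneg_left (abs_sub _ _) hκ.le)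
  rw [← abs_of_pos hκ, ← abs_mul]
  congr 1
  rw [trimmedMeanDiff_eq hα0 hβ0 hαβ, sum_additiveInfluence, hI, ← hβ, ← hα]
  simp only [hscore]
  rw [armSum_mul_const, armSum_mul_const]
  have hs1 : armShift τ true = τ := rfl
  have hs0 : armShift τ false = 0 := rfl
  rw [hs1, hs0]
  have h1 : 1 - (α + β) ≠ 0 := by linarith
  have e : ∀ A B C C' : ℝ, ((A * -(1 / σ ^ 2)) * B - (C * -(1 / σ ^ 2)) * C')
      / ((1 - β - α) / σ ^ 2) = 1 / (1 - (α + β)) * (C * C' - A * B) := fun A B C C' => by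
    rw [show 1 - β - α = 1 - (α + β) by ring]
    field_simp
    ring
  rw [e]
  -- The centering constants of the arms differ by `τ (1 - α - β)`, which the normalization turns
  -- into `τ`.
  have e2 : 1 / (1 - (α + β)) * (τ * (1 - (α + β))) = τ := by field_simp
  linear_combination √(n : ℝ) * e2

end Main

theorem mainTheorem6 {Ω : Type*} [MeasurableSpace Ω] (P : Measure Ω) [IsProbabilityMeasure P]
    (p : ℝ) (hp0 : 0 < p) (hp1 : p < 1)
    (Z : ℕ → Ω → Bool) (Y0 Y1 : ℕ → Ω → ℝ) (hexp : IsRandomizedExperiment P p Z Y0 Y1)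
    (k₁ k₂ μ σ τ : ℝ) (hk₁ : 0 < k₁) (hk₂ : 0 < k₂) (hσ : 0 < σ)
    (f₀ : ℝ → ℝ) (hf₀ : f₀ = huberDensity k₁ k₂ μ σ)
    (hY0 : ∀ i, P.map (Y0 i) = densityMeasure f₀)
    (hY1 : ∀ i, P.map (Y1 i) = (densityMeasure f₀).map (fun y => y + τ))
    (α β : ℝ) (hα : α = densityCDF f₀ (μ - σ * k₁)) (hβ : 1 - β = densityCDF f₀ (μ + σ * k₂)) :
    (0 < α ∧ 0 < β ∧ α + β < 1) ∧
    fisherInfo f₀ = (1 - α - β) / σ ^ 2 ∧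
    IsInformationBound p f₀ τ (1 / (p * (1 - p) * fisherInfo f₀)) ∧
    TendstoInDistribution
      (fun (n : ℕ) ω =>
        √(n : ℝ) * (trimmedMeanDiff α β n (fun i => observed Z Y0 Y1 i ω) - τ))
      atTop (id : ℝ → ℝ) (fun _ => P)
      (gaussianReal 0 (1 / (p * (1 - p) * fisherInfo f₀)).toNNReal) ∧
    IsEfficientEstimator P (observed Z Y0 Y1) (trimmedMeanDiff α β) p f₀ τ := by
  subst hf₀
  have h := huberDensity_hasLipschitzScore (μ := μ) hk₁ hk₂ hσ
  have hD := hexp.isRandomSample h hp0.le hp1.le hY0 hY1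
  have hab : μ - σ * k₁ < μ + σ * k₂ := by
    have := mul_pos hσ hk₁
    have := mul_pos hσ hk₂
    linarith
  have hα0 : 0 < α := hα ▸ h.densityCDF_pos _
  have hβ0 : 0 < β := by linarith [h.densityCDF_lt_one (μ + σ * k₂)]
  have hαβ : α + β < 1 := by linarith [h.densityCDF_strictMono hab]
  have hI : fisherInfo (huberDensity k₁ k₂ μ σ) = (1 - α - β) / σ ^ 2 := by
    rw [fisherInfo_huberDensity hk₁ hk₂ hσ, ← hα, ← hβ, sub_right_comm]
  have hI0 : 0 < fisherInfo (huberDensity k₁ k₂ μ σ) := by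
    rw [hI]
    have : 0 < 1 - α - β := by linarith
    positivity
  have hlin := tendstoInMeasure_trimmedMeanDiff hp0 hp1 hk₁ hk₂ hσ hD hα hβ
  obtain ⟨C, hC⟩ := h.exists_bound_additiveInfluence (p := p) (τ := τ)
  have hψ := h.measurable_additiveInfluence (p := p) (τ := τ)
  have hclt := hD.tendstoInDistribution_sum_div_sqrt hψ hC (h.integral_additiveInfluence hp0 hp1)
    (h.integral_additiveInfluence_sq hp0 hp1 hI0)
  have hT := fun n => measurable_trimmedMeanDiff hD.measurable hα0 hβ0 hαβ n
  refine ⟨⟨hα0, hβ0, hαβ⟩, hI, h.isInformationBound hp0 hp1 hI0, ?_,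
    ⟨_, h.isEfficientInfluenceFunction hp0 hp1 hI0, hlin⟩⟩
  -- Slutsky: the normalized sum of `ψ` has the Gaussian limit, and the linearization error tends to
  -- zero in probability.
  have hsum := hclt.add_of_tendstoInMeasure_const hlin fun n =>
    ((((hT n).sub_const τ).const_mul _).sub ((Finset.measurable_sum _ fun i _ =>
      hψ.comp (hD.measurable i)).div_const _)).aemeasurable
  refine hsum.congr (fun n => Eventually.of_forall fun ω => ?_) (Eventually.of_forall fun x => ?_)
  · simp only [Pi.add_apply, add_sub_cancel]
  · simp only [id, add_zero]
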